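/- **Setting.** Let $G=(\mathcal V,\mathcal E)$ be the complete graph on $n=|\mathcal V|\ge 3$ vertices. Travelling along an edge $e$ the robot observes a finite set of points; each point $p$ has a random nonnegative reward and each edge a random cost that is at most a constant $C$. For $\mathcal S\subseteq\mathcal E$ let $r(\mathcal S,y_r)$ be the sum of the rewards of the distinct points observed along the edges of $\mathcal S$, let $c(\mathcal S,y_c)$ be the sum of the costs of the edges of $\mathcal S$ and, for a fixed $\beta\in[0,1]$, put $$f(\mathcal S,y)=(1-\beta)\,r(\mathcal S,y_r)+\beta\,(|\mathcal S|C-c(\mathcal S,y_c)),\qquad y=(y_r,y_c)\ \text{random with an arbitrary law}.$$ For $\alpha\in(0,1]$ let $H(\mathcal S,\tau)=\tau-\frac1\alpha\mathbb E_y[(\tau-f(\mathcal S,y))^+]$. Let $\mathcal I$ be the family of all subsets of edge sets of Hamiltonian cycles of $G$, let $\Gamma>0$ and $\gamma\in(0,\Gamma]$, and let $(\mathcal S^\star,\tau^\star)$ maximize $H$ over $\mathcal I\times[0,\Gamma]$. **Curvature.** For $\tau>0$ let $h_\tau(\mathcal S)=H(\mathcal S,\tau)-H(\emptyset,\tau)$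 and $$k_\tau=1-\min_{\mathcal S\in\mathcal I,\ s\in\mathcal S,\ h_\tau(\{s\})\ne0}\frac{h_\tau(\mathcal S)-h_\tau(\mathcal S\setminus\{s\})}{h_\tau(\{s\})}$$ (with $k_\tau=1$ if $h_\tau(\{s\})=0$ for all edges $s$), and let $k=\max\{k_{i\gamma}: i\ge1,\ i\gamma\le\Gamma\}$. **Algorithm RAGA.** From $n_s$ independent samples $y_1,\dots,y_{n_s}$ of $y$, drawn once, form $\hat H(\mathcal S,\tau)=\tau-\frac1{\alpha n_s}\sum_j(\tau-f(\mathcal S,y_j))^+$. Set $\hat H_{\max}=0$. For $i=0,1,\dots,\lceil\Gamma/\gamma\rceil$ put $\tau_i=i\gamma$ and build a set $\mathcal S$ greedily: start with $\mathcal S=\emptyset$, $\hat H_{\rm cur}=0$ and all edges remaining. While edges remain and $|\mathcal S|\le|\mathcal V|$, take a remaining edge $e\notin\mathcal S$ that maximizes $\hat H(\mathcal S\cup\{e\},\tau_i)-\hat H(\mathcal S,\tau_i)$ (ties broken in any way); if both end points of $e$ have degree less than $2$ in $\mathcal S$ and $\mathcal S\cup\{e\}$ contains no cycle that misses a vertex,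 add $e$ to $\mathcal S$ and set $\hat H_{\rm cur}=\hat H(\mathcal S,\tau_i)$ for the new $\mathcal S$; in either case delete $e$ from the remaining edges. After this loop, if $\hat H_{\rm cur}\ge\hat H_{\max}$, set $\hat H_{\max}=\hat H_{\rm cur}$ and $(\mathcal S^G,\tau^G)=(\mathcal S,\tau_i)$; if $\hat H_{\rm cur}<0$, leave the loop over $i$. Return $(\mathcal S^G,\tau^G)$. **Theorem.** For every $n\ge3$ and $\alpha\in(0,1]$ there is a constant $K>0$, depending only on $n$ and $\alpha$, such that the following holds for all instances on $n$ vertices, all $\Gamma>0$, $\gamma\in(0,\Gamma]$ and all $\epsilon,\delta\in(0,1)$. If the number of samples satisfies $$n_s\ \ge\ K\,\frac{\Gamma^2}{\epsilon^2}\log\frac2\delta ,$$ then RAGA returns a Hamiltonian tour $\mathcal S^G$ and a scalar $\tau^G$ for every realization of the samples, and with probability at least $1-\delta$ over the samples, however ties are broken, $$H(\mathcal S^G,\tau^G)\ \ge\ \frac1{2+k}\big(H(\mathcal S^\star,\tau^\star)-\gamma\big)+\frac{1+k}{2+k}\,\Gamma\Big(1-\frac1\alpha\Big)-\epsilon .$$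 -/

import Mathlib

open MeasureTheory

namespace RiskTSP

/-- A risk-aware travelling salesperson instance on the complete graph with vertex set `V`. Travelling along the edge
`e` the robot observes the points `observed e`; `reward p` and `cost e` are the random reward of the point `p` and the
random cost of the edge `e`, driven by a pair of noises `(y_r, y_c)` with an arbitrary joint law. -/
structure Problem (V P Yr Yc : Type*) [MeasurableSpace Yr] [MeasurableSpace Yc] where
  observed : Sym2 V → Finset P
  reward : P → Yr → ℝ
  cost : Sym2 V → Yc → ℝ
  /-- the upper bound `C` on the edge costs -/
  costBound : ℝ
  /-- the weighting parameter -/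
  β : ℝ
  /-- the joint law of the noise `y = (y_r, y_c)` -/
  law : Measure (Yr × Yc)
  measurable_reward : ∀ p, Measurable (reward p)
  measurable_cost : ∀ e, Measurable (cost e)
  reward_nonneg : ∀ p y, 0 ≤ reward p y
  cost_le : ∀ e y, cost e y ≤ costBound
  β_nonneg : 0 ≤ β
  β_le_one : β ≤ 1
  isProbabilityMeasure_law : IsProbabilityMeasure law

section Tours

variable {V : Type*} [Fintype V] [DecidableEq V]

/-- The set of edges of the complete graph on `V`. -/
def allEdges (V : Type*) [Fintype V] [DecidableEq V] : Finset (Sym2 V) :=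
  (⊤ : SimpleGraph V).edgeFinset

/-- `A` is the edge set of a Hamiltonian cycle of the complete graph. -/
def IsTour (A : Finset (Sym2 V)) : Prop :=
  ∃ (v : V) (w : (⊤ : SimpleGraph V).Walk v v), w.IsHamiltonianCycle ∧ A = w.edges.toFinset

/-- The independence family: all subsets of Hamiltonian tours. -/
def feasible (V : Type*) [Fintype V] [DecidableEq V] : Set (Finset (Sym2 V)) :=
  {S | ∃ A, IsTour A ∧ S ⊆ A}

/-- The degree of `v` with respect to the edge set `S`. -/
def degree (S : Finset (Sym2 V)) (v : V) : ℕ := (S.filter (fun e => v ∈ e)).card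

/-- The edge set `S` contains a cycle that does not pass through all the vertices. -/
def HasSubtour (S : Finset (Sym2 V)) : Prop :=
  ∃ (v : V) (w : (SimpleGraph.fromEdgeSet (S : Set (Sym2 V))).Walk v v),
    w.IsCycle ∧ w.length < Fintype.card V

/-- The test of the algorithm: both end points of `e` have degree less than two in `S`, and adding `e` to `S` does not
create a subtour. -/
def Admissible (S : Finset (Sym2 V)) (e : Sym2 V) : Prop :=
  (∀ v ∈ e, degree S v < 2) ∧ ¬ HasSubtour (insert e S)

end Tours

section Objective

variable {V P Yr Yc : Type*} [Fintype V] [DecidableEq V] [DecidableEq P]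
  [MeasurableSpace Yr] [MeasurableSpace Yc]

/-- Total reward of the distinct points observed along the edges of `S`. -/
def Problem.totalReward (Q : Problem V P Yr Yc) (S : Finset (Sym2 V)) (y : Yr) : ℝ :=
  ∑ p ∈ S.biUnion Q.observed, Q.reward p y

/-- Total cost of the edges of `S`. -/
def Problem.totalCost (Q : Problem V P Yr Yc) (S : Finset (Sym2 V)) (y : Yc) : ℝ :=
  ∑ e ∈ S, Q.cost e y

/-- The utility `f(S, y) = (1 - β) r(S, y_r) + β (|S| C - c(S, y_c))`. -/
def Problem.utility (Q : Problem V P Yr Yc) (S : Finset (Sym2 V)) (y : Yr × Yc) : ℝ :=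
  (1 - Q.β) * Q.totalReward S y.1 + Q.β * (S.card * Q.costBound - Q.totalCost S y.2)

/-- The auxiliary function `H(S, τ) = τ - (1/α) 𝔼[(τ - f(S, y))⁺]`. -/
noncomputable def Problem.H (Q : Problem V P Yr Yc) (α : ℝ) (S : Finset (Sym2 V)) (τ : ℝ) : ℝ :=
  τ - 1 / α * ∫ y, max (τ - Q.utility S y) 0 ∂Q.law

/-- The sampling oracle: the auxiliary function of the empirical law of the samples `ys`. -/
noncomputable def Problem.sampledH (Q : Problem V P Yr Yc) (α : ℝ) {ns : ℕ} (ys : Fin ns → Yr × Yc)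
    (S : Finset (Sym2 V)) (τ : ℝ) : ℝ :=
  τ - 1 / α * ((1 / (ns : ℝ)) * ∑ j, max (τ - Q.utility S (ys j)) 0)

/-- `(S, τ)` solves the risk-aware problem: it maximizes `H` over the feasible sets and over `[0, Γ]`. -/
def Problem.IsOptimal (Q : Problem V P Yr Yc) (α Γ : ℝ) (S : Finset (Sym2 V)) (τ : ℝ) : Prop :=
  S ∈ feasible V ∧ τ ∈ Set.Icc 0 Γ ∧
    ∀ S' ∈ feasible V, ∀ τ' ∈ Set.Icc 0 Γ, Q.H α S' τ' ≤ Q.H α S τ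

/-- The curvature of a normalized set function `h` over a family of sets,
`1 - min (h(S) - h(S \ {s})) / h({s})` over the members `S` of the family and the `s ∈ S` with `h({s}) ≠ 0`. -/
noncomputable def curvature {E : Type*} [DecidableEq E] (family : Set (Finset E)) (h : Finset E → ℝ) : ℝ :=
  1 - sInf {ρ | ∃ S ∈ family, ∃ s ∈ S, h {s} ≠ 0 ∧ ρ = (h S - h (S.erase s)) / h {s}}

/-- The curvature of `H(S, τ)` in `S`: the largest curvature of the normalized functions `S ↦ H(S, τ) - H(∅, τ)`, over
the positive search values `τ = i γ` in `[0, Γ]` (for `τ = 0` the normalized function is identically zero). -/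
noncomputable def Problem.curvatureH (Q : Problem V P Yr Yc) (α Γ γ : ℝ) : ℝ :=
  sSup {κ | ∃ i : ℕ, 0 < i ∧ (i : ℝ) * γ ≤ Γ ∧
    κ = curvature (feasible V) (fun S => Q.H α S (i * γ) - Q.H α ∅ (i * γ))}

end Objective

section Algorithm

variable {V : Type*} [Fintype V] [DecidableEq V]

/-- `e` is an edge of `R \ S` of maximal marginal gain of `h` at `S`; any tie-breaking is allowed. -/
def IsGreedyChoice (h : Finset (Sym2 V) → ℝ) (R S : Finset (Sym2 V)) (e : Sym2 V) : Prop :=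
  e ∈ R \ S ∧ ∀ e' ∈ R \ S, h (insert e' S) - h S ≤ h (insert e S) - h S

/-- `GreedyRun h R S c S' c'`: the inner loop of the algorithm, started with remaining edges `R`, chosen edges `S` and
current value `c`, can terminate with chosen edges `S'` and current value `c'`. -/
inductive GreedyRun (h : Finset (Sym2 V) → ℝ) :
    Finset (Sym2 V) → Finset (Sym2 V) → ℝ → Finset (Sym2 V) → ℝ → Prop
  | halt {R S : Finset (Sym2 V)} {c : ℝ} (hend : ¬ (R ≠ ∅ ∧ S.card ≤ Fintype.card V)) :
      GreedyRun h R S c S c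
  | accept {R S S' : Finset (Sym2 V)} {c c' : ℝ} {e : Sym2 V} (hloop : R ≠ ∅ ∧ S.card ≤ Fintype.card V)
      (hchoice : IsGreedyChoice h R S e) (hadm : Admissible S e)
      (hrest : GreedyRun h (R.erase e) (insert e S) (h (insert e S)) S' c') :
      GreedyRun h R S c S' c'
  | reject {R S S' : Finset (Sym2 V)} {c c' : ℝ} {e : Sym2 V} (hloop : R ≠ ∅ ∧ S.card ≤ Fintype.card V)
      (hchoice : IsGreedyChoice h R S e) (hadm : ¬ Admissible S e)
      (hrest : GreedyRun h (R.erase e) S c S' c') :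
      GreedyRun h R S c S' c'

/-- `SearchRun Hhat γ N i m b b'`: the outer loop over `τ = i γ`, `i ≤ N`, started at the index `i` with best value `m`
and best pair `b`, can terminate with best pair `b'`. -/
inductive SearchRun (Hhat : Finset (Sym2 V) → ℝ → ℝ) (γ : ℝ) (N : ℕ) :
    ℕ → ℝ → Finset (Sym2 V) × ℝ → Finset (Sym2 V) × ℝ → Prop
  | finish {i : ℕ} {m : ℝ} {b : Finset (Sym2 V) × ℝ} (hi : N < i) : SearchRun Hhat γ N i m b b
  | exit {i : ℕ} {m c : ℝ} {b : Finset (Sym2 V) × ℝ} {S : Finset (Sym2 V)} (hi : i ≤ N)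
      (hrun : GreedyRun (fun T => Hhat T (i * γ)) (allEdges V) ∅ 0 S c) (hc : c < 0) :
      SearchRun Hhat γ N i m b (if m ≤ c then (S, i * γ) else b)
  | next {i : ℕ} {m c : ℝ} {b b' : Finset (Sym2 V) × ℝ} {S : Finset (Sym2 V)} (hi : i ≤ N)
      (hrun : GreedyRun (fun T => Hhat T (i * γ)) (allEdges V) ∅ 0 S c) (hc : ¬ c < 0)
      (hrest : SearchRun Hhat γ N (i + 1) (if m ≤ c then c else m) (if m ≤ c then (S, i * γ) else b) b') :
      SearchRun Hhat γ N i m b b'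

/-- The algorithm RAGA, run with the oracle `Hhat`, can return the pair `(S, τ)`. -/
def RAGAReturns (Hhat : Finset (Sym2 V) → ℝ → ℝ) (Γ γ : ℝ) (S : Finset (Sym2 V)) (τ : ℝ) : Prop :=
  SearchRun Hhat γ ⌈Γ / γ⌉₊ 0 0 (∅, 0) (S, τ)

end Algorithm

end RiskTSP

/-! Greedy bound. Partial tours are loopless edge sets with degrees at most two in which every
nonempty proper vertex set `W` spans fewer than `|W|` edges. For `n ≥ 3` they are exactly the
subsets of Hamiltonian tours, and the test of the algorithm is membership in this class, so every
greedy run ends in a tour. Orient a tour `O` containing the optimal set, and let the hybrid of a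
partial tour `S` be `S` together with the edges of `O` whose tail is untouched by `S` and whose head
has degree below two in `S`. The hybrid is a partial tour (`isPartialTour_hybrid`); it equals `O` at
the start of the run and the greedy tour at the end. A greedy step of gain `ρ` removes at most two
edges of `O` from it (`card_retained_sdiff_le`), which costs at most `2ρ` by submodularity and
greediness, while inserting the new edge regains at least `(1 - k)ρ` by curvature. Summing the
losses `(1 + k)ρ` gives `h(O) ≤ (2 + k) h(S') - (1 + k) h(∅)` up to sampling error
(`GreedyRun.tour_le`), and `H(∅, τ) = τ(1 - 1/α)`.

Sampling. The number of search values is not bounded in terms of `n` and `α`, so a union bound over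
them is not affordable. For fixed `S`, however, every expected shortfall is `τ` minus `τ` times the
mean of a monotone `[0,1]`-valued function of the one variable `f(S, y)`. After symmetrization, all
signed sums of such functions are dominated at once by the largest partial sum of the signs in
sorted order, which is subgaussian. This gives a bound of Dvoretzky-Kiefer-Wolfowitz type, uniform
in `τ` (`measure_monotone_deviation_le`); the union bound runs only over edge sets.

Search. Rounding the optimal `τ` down to the grid costs at most `γ`. If the loop stopped earlier at
a negative value, the fact that `H(O, τ) / τ` is nonincreasing (`Problem.mul_H_le_mul_H`) carries
the greedy bound from the stopping value to the later one. -/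

namespace RiskTSP

/-! ### Combinatorics of partial tours -/

section PartialTours

variable {V : Type*} [Fintype V] [DecidableEq V]

/-- The edges of `F` with both end points in `W`. -/
def inside (F : Finset (Sym2 V)) (W : Finset V) : Finset (Sym2 V) := F.filter (fun e => e ∈ W.sym2)

/-- Partial tours, described by degree and subtour elimination constraints. -/
structure IsPartialTour (F : Finset (Sym2 V)) : Prop where
  loopless : ∀ e ∈ F, ¬ e.IsDiag
  degree_le : ∀ v, degree F v ≤ 2
  sparse : ∀ W : Finset V, W.Nonempty → W ≠ Finset.univ → (inside F W).card < W.card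

omit [Fintype V] in
lemma mem_inside {F : Finset (Sym2 V)} {W : Finset V} {e : Sym2 V} :
    e ∈ inside F W ↔ e ∈ F ∧ ∀ v ∈ e, v ∈ W := by
  simp [inside, Finset.mem_sym2_iff]

omit [Fintype V] in
lemma inside_mono {F F' : Finset (Sym2 V)} (h : F ⊆ F') (W : Finset V) : inside F W ⊆ inside F' W :=
  Finset.filter_subset_filter _ h

omit [Fintype V] in
lemma inside_subset (F : Finset (Sym2 V)) (W : Finset V) : inside F W ⊆ F := Finset.filter_subset _ _

omit [Fintype V] in
lemma degree_mono {F F' : Finset (Sym2 V)} (h : F ⊆ F') (v : V) : degree F v ≤ degree F' v :=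
  Finset.card_le_card (Finset.filter_subset_filter _ h)

omit [Fintype V] in
lemma degree_insert {F : Finset (Sym2 V)} {e : Sym2 V} (he : e ∉ F) (v : V) :
    degree (insert e F) v = degree F v + if v ∈ e then 1 else 0 := by
  unfold degree
  rw [Finset.filter_insert]
  split_ifs with h
  · rw [Finset.card_insert_of_notMem (by simp [he])]
  · simp

lemma IsPartialTour.mono {F F' : Finset (Sym2 V)} (h : F ⊆ F') (hF : IsPartialTour F') : IsPartialTour F where
  loopless e he := hF.loopless e (h he)
  degree_le v := (degree_mono h v).trans (hF.degree_le v)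
  sparse W h1 h2 := (Finset.card_le_card (inside_mono h W)).trans_lt (hF.sparse W h1 h2)

lemma isPartialTour_empty : IsPartialTour (∅ : Finset (Sym2 V)) where
  loopless := by simp
  degree_le := by simp [degree]
  sparse W h1 _ := by simpa [inside] using h1

/-- Edge by edge: the number of end points in `W`, plus one if both lie outside, equals one, plus
one if both lie inside. -/
lemma sum_degree_add {F : Finset (Sym2 V)} (hF : ∀ e ∈ F, ¬ e.IsDiag) (W : Finset V) :
    ∑ v ∈ W, degree F v + (inside F Wᶜ).card = (inside F W).card + F.card := by
  have h1 : ∑ v ∈ W, degree F v = ∑ e ∈ F, (W.filter (fun v => v ∈ e)).card :=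
    Finset.sum_card_bipartiteAbove_eq_sum_card_bipartiteBelow (fun v e => v ∈ e)
  rw [h1, inside, inside, Finset.card_filter, Finset.card_filter, ← Finset.sum_add_distrib,
    Finset.card_eq_sum_ones F, ← Finset.sum_add_distrib]
  refine Finset.sum_congr rfl fun e he => ?_
  have hd := hF e he
  induction e with | _ a b =>
  have hab : a ≠ b := by simpa using hd
  have h2 : (W.filter (fun v => v ∈ s(a, b))).card = (if a ∈ W then 1 else 0) + if b ∈ W then 1 else 0 := by
    have : W.filter (fun v => v ∈ s(a, b)) = (if a ∈ W then {a} else ∅) ∪ (if b ∈ W then {b} else ∅) := by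
      ext v
      split_ifs <;> simp <;> grind
    rw [this, Finset.card_union_of_disjoint]
    · split_ifs <;> simp
    · split_ifs <;> simp [hab]
  rw [h2]
  simp only [Finset.mk_mem_sym2_iff, Finset.mem_compl]
  split_ifs <;> simp_all

lemma sum_degree {F : Finset (Sym2 V)} (hF : ∀ e ∈ F, ¬ e.IsDiag) : ∑ v, degree F v = 2 * F.card := by
  have h := sum_degree_add hF Finset.univ
  have h1 : inside F (Finset.univ : Finset V) = F := by ext; simp [mem_inside]
  have h2 : inside F ((Finset.univ : Finset V)ᶜ) = ∅ := by
    ext e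
    simp only [mem_inside, Finset.compl_univ, Finset.notMem_empty, iff_false, not_and]
    exact fun _ h => h _ e.out_fst_mem
  rw [h1, h2] at h
  simp at h
  omega

lemma IsPartialTour.card_le {F : Finset (Sym2 V)} (hF : IsPartialTour F) : F.card ≤ Fintype.card V := by
  have h := sum_degree hF.loopless
  have h2 : ∑ v, degree F v ≤ ∑ _v : V, 2 := Finset.sum_le_sum fun v _ => hF.degree_le v
  simp at h2
  omega

omit [Fintype V] in
lemma card_inside_supermodular (F : Finset (Sym2 V)) (W₁ W₂ : Finset V) :
    (inside F W₁).card + (inside F W₂).card ≤ (inside F (W₁ ∪ W₂)).card + (inside F (W₁ ∩ W₂)).card := by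
  have h1 : inside F W₁ ∪ inside F W₂ ⊆ inside F (W₁ ∪ W₂) := by
    intro e; simp only [Finset.mem_union, mem_inside]; grind
  have h2 : inside F W₁ ∩ inside F W₂ ⊆ inside F (W₁ ∩ W₂) := by
    intro e; simp only [Finset.mem_inter, mem_inside]; grind
  have := Finset.card_union_add_card_inter (inside F W₁) (inside F W₂)
  have := Finset.card_le_card h1
  have := Finset.card_le_card h2
  omega

/-- Adding an edge between two vertices of degree less than two that lie in no common tight set keeps the constraints. -/
lemma IsPartialTour.insert_of_no_tight {F : Finset (Sym2 V)} (hF : IsPartialTour F) (hn : 3 ≤ Fintype.card V)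
    {u v : V} (huv : u ≠ v) (hu : degree F u < 2) (hv : degree F v < 2)
    (ht : ∀ W : Finset V, W ≠ Finset.univ → u ∈ W → v ∈ W → (inside F W).card + 1 < W.card) :
    s(u, v) ∉ F ∧ IsPartialTour (insert s(u, v) F) := by
  have hnot : s(u, v) ∉ F := by
    intro h
    have h2 : ({u, v} : Finset V).card = 2 := Finset.card_pair huv
    have h1 := ht {u, v} (by intro h3; rw [h3, Finset.card_univ] at h2; omega) (by simp) (by simp)
    have : 0 < (inside F {u, v}).card := Finset.card_pos.2 ⟨s(u, v), by simp [mem_inside, h]⟩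
    omega
  refine ⟨hnot, ?_, ?_, ?_⟩
  · intro e he
    rcases Finset.mem_insert.1 he with rfl | he
    · simpa using huv
    · exact hF.loopless e he
  · intro w
    rw [degree_insert hnot]
    have := hF.degree_le w
    split_ifs with h
    · rcases Sym2.mem_iff.1 h with rfl | rfl <;> omega
    · simpa
  · intro W h1 h2
    have h3 := hF.sparse W h1 h2
    by_cases h : u ∈ W ∧ v ∈ W
    · have h4 := ht W h2 h.1 h.2
      have h5 : inside (insert s(u, v) F) W ⊆ insert s(u, v) (inside F W) := by
        intro e; simp only [mem_inside, Finset.mem_insert]; tauto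
      have := Finset.card_le_card h5
      have := Finset.card_insert_le s(u, v) (inside F W)
      omega
    · have h5 : inside (insert s(u, v) F) W ⊆ inside F W := by
        intro e; simp only [mem_inside, Finset.mem_insert]
        rintro ⟨rfl | h6, h7⟩
        · exact absurd ⟨h7 u (by simp), h7 v (by simp)⟩ h
        · exact ⟨h6, h7⟩
      have := Finset.card_le_card h5
      omega

/-- The deficits `2 - degree` add up to `2(n - |F|)`. Joining two vertices of positive deficit can
only fail through a tight set, a proper `W` spanning `|W| - 1` edges and containing both, so the
task is to find a pair in no common tight set. -/
lemma IsPartialTour.exists_insert {F : Finset (Sym2 V)} (hF : IsPartialTour F) (hn : 3 ≤ Fintype.card V)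
    (hcard : F.card < Fintype.card V) : ∃ e, e ∉ F ∧ IsPartialTour (insert e F) := by
  have hsum := sum_degree hF.loopless
  have hdef : ∑ v, (2 - degree F v) + ∑ v, degree F v = 2 * Fintype.card V := by
    rw [← Finset.sum_add_distrib, Finset.sum_congr rfl (fun v _ => Nat.sub_add_cancel (hF.degree_le v))]
    simp [mul_comm]
  have hdefW : ∀ W : Finset V, ∑ v ∈ W, (2 - degree F v) + ∑ v ∈ W, degree F v = 2 * W.card := by
    intro W
    rw [← Finset.sum_add_distrib, Finset.sum_congr rfl (fun v _ => Nat.sub_add_cancel (hF.degree_le v))]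
    simp [mul_comm]
  have hcompl : ∀ W : Finset V, (inside F W).card + (inside F Wᶜ).card ≤ F.card := by
    intro W
    rw [← Finset.card_union_of_disjoint]
    · exact Finset.card_le_card (Finset.union_subset (inside_subset _ _) (inside_subset _ _))
    · rw [Finset.disjoint_left]
      intro e h1 h2
      induction e with | _ a b =>
      have := (mem_inside.1 h1).2 a (by simp)
      have := (mem_inside.1 h2).2 a (by simp)
      simp_all
  obtain ⟨u, hu⟩ : ∃ u, degree F u < 2 := by
    by_contra! h
    have : ∑ v, (2 - degree F v) = 0 := Finset.sum_eq_zero fun v _ => by have := h v; omega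
    omega
  have hWu : ∀ W : Finset V, u ∈ W → W.Nonempty := fun W h => ⟨u, h⟩
  rcases Nat.lt_or_ge (F.card + 1) (Fintype.card V) with hlt | hge
  · -- take a maximal tight set around `u`
    obtain ⟨M, hM, hmax⟩ := Finset.exists_max_image
      (Finset.univ.filter fun W : Finset V => u ∈ W ∧ W ≠ Finset.univ ∧ W.card ≤ (inside F W).card + 1) Finset.card
      ⟨{u}, by
        simp only [Finset.mem_filter, Finset.mem_univ, true_and, Finset.mem_singleton, Finset.card_singleton]
        refine ⟨?_, by omega⟩
        intro h
        have := congrArg Finset.card h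
        rw [Finset.card_univ, Finset.card_singleton] at this
        omega⟩
    simp only [Finset.mem_filter, Finset.mem_univ, true_and] at hM hmax
    obtain ⟨huM, hMu, hMt⟩ := hM
    -- A tight set has total deficit at most two, whereas the whole graph has at least four here, so
    -- some vertex of positive deficit lies outside `M`.
    have hMdef : ∑ v ∈ M, (2 - degree F v) ≤ 2 := by
      have h1 := hdefW M
      have h2 := sum_degree_add hF.loopless M
      have h3 := hcompl M
      omega
    obtain ⟨v, hvM, hv⟩ : ∃ v, v ∉ M ∧ degree F v < 2 := by
      by_contra! h
      have h1 : ∑ v, (2 - degree F v) = ∑ v ∈ M, (2 - degree F v) :=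
        (Finset.sum_subset (Finset.subset_univ M) (fun v _ hv => by have := h v hv; omega)).symm
      omega
    have huv : u ≠ v := by rintro rfl; exact hvM huM
    refine ⟨s(u, v), hF.insert_of_no_tight hn huv hu hv ?_⟩
    intro W hW huW hvW
    by_contra! hWt
    -- Uncrossing: the union of two intersecting tight sets is again tight. It would contradict the
    -- maximality of `M`, or, if it is everything, force `|F| ≥ n - 1`.
    have h1 := card_inside_supermodular F W M
    have h2 := Finset.card_union_add_card_inter W M
    have h3 := hF.sparse (W ∩ M) ⟨u, by simp [huW, huM]⟩
      (by intro h; exact hMu (Finset.eq_univ_of_forall fun x => (Finset.mem_inter.1 (h ▸ Finset.mem_univ x)).2))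
    by_cases hU : W ∪ M = Finset.univ
    · have h4 : (inside F (W ∪ M)).card ≤ F.card := Finset.card_le_card (inside_subset _ _)
      have h5 : (W ∪ M).card = Fintype.card V := by rw [hU, Finset.card_univ]
      omega
    · have h4 := hmax (W ∪ M) ⟨by simp [huW], hU, by omega⟩
      have h5 : M ⊂ W ∪ M := Finset.ssubset_iff_subset_ne.2
        ⟨Finset.subset_union_right, fun h => hvM (by rw [h]; simp [hvW])⟩
      have := Finset.card_lt_card h5
      omega
  -- Now `|F| = n - 1` and the total deficit is two. If `u` were isolated, its complement would span
  -- too many edges; so the deficit is shared by two vertices. A tight set containing both would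
  -- make its complement violate sparsity.
  · have hu0 : degree F u ≠ 0 := by
      intro h0
      have h1 := sum_degree_add hF.loopless {u}
      have h2 : (inside F {u}).card = 0 := by
        have := hF.sparse {u} ⟨u, by simp⟩ (by
          intro h
          have := congrArg Finset.card h
          rw [Finset.card_univ, Finset.card_singleton] at this
          omega)
        simp only [Finset.card_singleton] at this
        omega
      have h3 := hF.sparse ({u}ᶜ) (by
        rw [← Finset.card_pos, Finset.card_compl, Finset.card_singleton]; omega) (by
        intro h
        have := Finset.mem_univ u
        rw [← h] at this
        simp at this)
      rw [Finset.card_compl, Finset.card_singleton] at h3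
      simp only [Finset.sum_singleton] at h1
      omega
    obtain ⟨v, huv, hv⟩ : ∃ v, v ≠ u ∧ degree F v < 2 := by
      by_contra! h
      have h1 : ∑ v, (2 - degree F v) = 2 - degree F u :=
        Finset.sum_eq_single u (fun v _ hv => by have := h v hv; omega) (by simp)
      omega
    refine ⟨s(u, v), hF.insert_of_no_tight hn huv.symm hu hv ?_⟩
    intro W hW huW hvW
    by_contra! hWt
    have h1 := sum_degree_add hF.loopless W
    have h2 := hdefW W
    have h3 : 2 ≤ ∑ v ∈ W, (2 - degree F v) := by
      have : ∑ x ∈ ({u, v} : Finset V), (2 - degree F x) ≤ ∑ x ∈ W, (2 - degree F x) :=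
        Finset.sum_le_sum_of_subset (by intro x; simp; rintro (rfl | rfl) <;> assumption)
      rw [Finset.sum_pair huv.symm] at this
      omega
    have h4 := hF.sparse W (hWu W huW) hW
    have h5 := hF.sparse Wᶜ (by
      rw [← Finset.card_pos, Finset.card_compl]
      have := (Finset.card_lt_iff_ne_univ W).2 hW
      omega) (by
      intro h
      have := Finset.mem_univ u
      rw [← h] at this
      simp [huW] at this)
    have := (Finset.card_lt_iff_ne_univ W).2 hW
    rw [Finset.card_compl] at h5
    omega

lemma card_edgeFinset_lt_of_isAcyclic {U : Type*} [Fintype U] [Nonempty U] (G : SimpleGraph U) [Fintype G.edgeSet]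
    (hG : G.IsAcyclic) : G.edgeFinset.card < Fintype.card U := by
  classical
  obtain ⟨T, hGT, hT⟩ := SimpleGraph.exists_maximal_isAcyclic_of_le_isAcyclic (le_top : G ≤ ⊤) hG
  have hT' : T.IsTree := SimpleGraph.isTree_iff_maximal_isAcyclic.2 ⟨inferInstance, by simpa using hT⟩
  have h1 := hT'.card_edgeFinset
  have h2 : G.edgeFinset.card ≤ T.edgeFinset.card := Finset.card_le_card (SimpleGraph.edgeFinset_mono hGT)
  omega

-- The graph induced on `W` has too many edges to be a forest; a cycle found in the induced graph
-- has at most `|W|` vertices.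
omit [Fintype V] in
lemma fromEdgeSet_inside_cycle {F : Finset (Sym2 V)} (hF : ∀ e ∈ F, ¬ e.IsDiag) {W : Finset V} (hW : W.Nonempty)
    (hcard : W.card ≤ (inside F W).card) :
    ∃ (v : V) (w : (SimpleGraph.fromEdgeSet (F : Set (Sym2 V))).Walk v v), w.IsCycle ∧ w.length ≤ W.card := by
  classical
  set G := SimpleGraph.fromEdgeSet (F : Set (Sym2 V)) with hG
  let H : SimpleGraph W := G.comap Subtype.val
  have : Nonempty W := hW.to_subtype
  have hcyc : ¬ H.IsAcyclic := by
    intro hac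
    have h1 := card_edgeFinset_lt_of_isAcyclic H hac
    have h2 : inside F W ⊆ H.edgeFinset.image (Sym2.map Subtype.val) := by
      intro e he
      rw [mem_inside] at he
      have hd := hF e he.1
      induction e with | _ a b =>
      have ha := he.2 a (by simp)
      have hb := he.2 b (by simp)
      rw [Finset.mem_image]
      refine ⟨s(⟨a, ha⟩, ⟨b, hb⟩), ?_, by simp⟩
      rw [SimpleGraph.mem_edgeFinset, SimpleGraph.mem_edgeSet]
      simp only [H, SimpleGraph.comap_adj, hG, SimpleGraph.fromEdgeSet_adj]
      exact ⟨he.1, by simpa using hd⟩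
    have h3 := (Finset.card_le_card h2).trans Finset.card_image_le
    rw [Fintype.card_coe] at h1
    omega
  unfold SimpleGraph.IsAcyclic at hcyc
  push Not at hcyc
  obtain ⟨v, w, hw⟩ := hcyc
  let φ : H →g G := ⟨Subtype.val, fun h => h⟩
  refine ⟨φ v, w.map φ, hw.map Subtype.val_injective, ?_⟩
  rw [SimpleGraph.Walk.length_map]
  have h1 := hw.support_nodup.length_le_card
  rw [List.length_tail, SimpleGraph.Walk.length_support, Fintype.card_coe] at h1
  simpa using h1

omit [Fintype V] in
lemma card_edges_toFinset_of_isCycle {G : SimpleGraph V} {v : V} {w : G.Walk v v} (hw : w.IsCycle) :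
    w.edges.toFinset.card = w.length := by
  rw [List.toFinset_card_of_nodup hw.edges_nodup, SimpleGraph.Walk.length_edges]

omit [Fintype V] in
lemma card_support_toFinset_of_isCycle {G : SimpleGraph V} {v : V} {w : G.Walk v v} (hw : w.IsCycle) :
    w.support.toFinset.card = w.length := by
  have h1 : w.support.toFinset = w.support.tail.toFinset := by
    ext x
    simp only [List.mem_toFinset]
    rw [SimpleGraph.Walk.mem_support_iff]
    constructor
    · rintro (rfl | h)
      · exact SimpleGraph.Walk.end_mem_tail_support hw.not_nil
      · exact h
    · exact Or.inr
  rw [h1, List.toFinset_card_of_nodup hw.support_nodup, List.length_tail, SimpleGraph.Walk.length_support]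
  simp

lemma IsPartialTour.card_le_length {F : Finset (Sym2 V)} (hF : IsPartialTour F) {v : V}
    {w : (SimpleGraph.fromEdgeSet (F : Set (Sym2 V))).Walk v v} (hw : w.IsCycle) :
    Fintype.card V ≤ w.length := by
  by_contra! hlt
  have h1 := card_support_toFinset_of_isCycle hw
  have h2 := card_edges_toFinset_of_isCycle hw
  have h3 : w.edges.toFinset ⊆ inside F w.support.toFinset := by
    intro e he
    rw [List.mem_toFinset] at he
    rw [mem_inside]
    refine ⟨?_, fun x hx => List.mem_toFinset.2 (SimpleGraph.Walk.mem_support_of_mem_edges he hx)⟩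
    have := w.edges_subset_edgeSet he
    rw [SimpleGraph.edgeSet_fromEdgeSet] at this
    exact this.1
  have h4 := hF.sparse w.support.toFinset ⟨v, by simp⟩
    (by intro h; rw [h, Finset.card_univ] at h1; omega)
  have := Finset.card_le_card h3
  omega

lemma IsPartialTour.not_hasSubtour {F : Finset (Sym2 V)} (hF : IsPartialTour F) : ¬ HasSubtour F := by
  rintro ⟨v, w, hw, hlt⟩
  have := hF.card_le_length hw
  omega

lemma sparse_of_not_hasSubtour {F : Finset (Sym2 V)} (hF : ∀ e ∈ F, ¬ e.IsDiag) (h : ¬ HasSubtour F)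
    (W : Finset V) (h1 : W.Nonempty) (h2 : W ≠ Finset.univ) : (inside F W).card < W.card := by
  by_contra! hc
  obtain ⟨v, w, hw, hl⟩ := fromEdgeSet_inside_cycle hF h1 hc
  exact h ⟨v, w, hw, hl.trans_lt ((Finset.card_lt_iff_ne_univ W).2 h2)⟩

/-- Sparsity and the absence of subtours are interchangeable for loopless sets, so the analysis of
the algorithm can use counting constraints in place of cycles. -/
lemma admissible_iff {S : Finset (Sym2 V)} (hS : IsPartialTour S) {e : Sym2 V} (he : e ∉ S) (hd : ¬ e.IsDiag) :
    Admissible S e ↔ IsPartialTour (insert e S) := by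
  have hl : ∀ e' ∈ insert e S, ¬ e'.IsDiag := by
    intro e' he'
    rcases Finset.mem_insert.1 he' with rfl | h
    · exact hd
    · exact hS.loopless _ h
  constructor
  · rintro ⟨h1, h2⟩
    refine ⟨hl, fun v => ?_, sparse_of_not_hasSubtour hl h2⟩
    rw [degree_insert he]
    split_ifs with h
    · have := h1 v h; omega
    · simpa using hS.degree_le v
  · intro h
    refine ⟨fun v hv => ?_, h.not_hasSubtour⟩
    have := h.degree_le v
    rw [degree_insert he, if_pos hv] at this
    omega

/-- As many edges as vertices force a cycle; shorter cycles are excluded by sparsity, so it has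
length `n` and exhausts `F`. -/
lemma IsPartialTour.isTour {F : Finset (Sym2 V)} (hF : IsPartialTour F) (hn : 3 ≤ Fintype.card V)
    (hcard : F.card = Fintype.card V) : IsTour F := by
  have huniv : inside F (Finset.univ : Finset V) = F := by ext; simp [mem_inside]
  have : Nonempty V := Fintype.card_pos_iff.1 (by omega)
  obtain ⟨v, w, hw, hl⟩ := fromEdgeSet_inside_cycle hF.loopless (Finset.univ_nonempty (α := V))
    (by rw [huniv, hcard, Finset.card_univ])
  rw [Finset.card_univ] at hl
  have hlen := le_antisymm hl (hF.card_le_length hw)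
  have hsub : w.edges.toFinset ⊆ F := by
    intro e he
    rw [List.mem_toFinset] at he
    have := w.edges_subset_edgeSet he
    rw [SimpleGraph.edgeSet_fromEdgeSet] at this
    exact this.1
  have heq : w.edges.toFinset = F :=
    Finset.eq_of_subset_of_card_le hsub (by rw [card_edges_toFinset_of_isCycle hw, hlen, hcard])
  refine ⟨v, w.mapLe le_top, ?_, by rw [SimpleGraph.Walk.edges_mapLe_eq_edges, heq]⟩
  rw [SimpleGraph.Walk.isHamiltonianCycle_iff_isCycle_and_length_eq]
  refine ⟨hw.mapLe _, ?_⟩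
  simpa using hlen

end PartialTours

/-! ### Oriented tours and hybrids -/

section Orientation

variable {V : Type*} [Fintype V] [DecidableEq V]

/-- `O` is a tour, traversed so that the edge `e` leads from `tail e` to `head e`. -/
structure IsOrientedTour (O : Finset (Sym2 V)) (tail head : Sym2 V → V) : Prop where
  isPartialTour : IsPartialTour O
  eq_mk : ∀ e ∈ O, e = s(tail e, head e)
  tail_inj : Set.InjOn tail O
  head_inj : Set.InjOn head O

lemma exists_crossing_dart {G : SimpleGraph V} {v : V} (w : G.Walk v v) (hw : ∀ x, x ∈ w.support)
    {W : Finset V} (h1 : W.Nonempty) (h2 : W ≠ Finset.univ) : ∃ d ∈ w.darts, d.fst ∈ W ∧ d.snd ∉ W := by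
  obtain ⟨u, hu⟩ := h1
  obtain ⟨x, hx⟩ : ∃ x, x ∉ W := by
    by_contra! h
    exact h2 (Finset.eq_univ_of_forall h)
  by_cases hv : v ∈ W
  · obtain ⟨d, hd, hd'⟩ := (w.takeUntil x (hw x)).exists_boundary_dart (W : Set V) hv hx
    exact ⟨d, w.darts_takeUntil_subset_darts (hw x) hd, hd'⟩
  · obtain ⟨d, hd, hd'⟩ := (w.dropUntil u (hw u)).exists_boundary_dart (W : Set V) hu hv
    exact ⟨d, w.darts_dropUntil_subset_darts (hw u) hd, hd'⟩

lemma IsTour.exists_orientation {O : Finset (Sym2 V)} (hO : IsTour O) :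
    ∃ tail head, IsOrientedTour O tail head := by
  obtain ⟨v, w, hw, rfl⟩ := hO
  have hcyc := hw.isCycle
  have hdart : ∀ e : Sym2 V, ∃ p : V × V,
      e ∈ w.edges → ∃ d ∈ w.darts, d.edge = e ∧ d.fst = p.1 ∧ d.snd = p.2 := by
    intro e
    by_cases he : e ∈ w.edges
    · obtain ⟨d, hd, hde⟩ := List.mem_map.1 he
      exact ⟨(d.fst, d.snd), fun _ => ⟨d, hd, hde, rfl, rfl⟩⟩
    · exact ⟨(v, v), fun h => absurd h he⟩
  choose p hp using hdart
  have hfst : ∀ d ∈ w.darts, ∀ d' ∈ w.darts, d.fst = d'.fst → d = d' := by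
    intro d hd d' hd' h
    have hnd : (w.darts.map (·.fst)).Nodup := by
      rw [SimpleGraph.Walk.map_fst_darts]; exact hcyc.nodup_dropLast_support
    exact List.inj_on_of_nodup_map hnd hd hd' h
  have hsnd : ∀ d ∈ w.darts, ∀ d' ∈ w.darts, d.snd = d'.snd → d = d' := by
    intro d hd d' hd' h
    have hnd : (w.darts.map (·.snd)).Nodup := by
      rw [SimpleGraph.Walk.map_snd_darts]; exact hcyc.support_nodup
    exact List.inj_on_of_nodup_map hnd hd hd' h
  have heq : ∀ e ∈ w.edges.toFinset, e = s((p e).1, (p e).2) := by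
    intro e he
    obtain ⟨d, _, h1, h2, h3⟩ := hp e (List.mem_toFinset.1 he)
    rw [← h2, ← h3, ← h1]; rfl
  have htail : Set.InjOn (fun e => (p e).1) (w.edges.toFinset : Set (Sym2 V)) := by
    intro e he e' he' h
    obtain ⟨d, hd, h1, h2, h3⟩ := hp e (List.mem_toFinset.1 he)
    obtain ⟨d', hd', h1', h2', h3'⟩ := hp e' (List.mem_toFinset.1 he')
    rw [← h1, ← h1', hfst d hd d' hd' (by rw [h2, h2']; exact h)]
  have hhead : Set.InjOn (fun e => (p e).2) (w.edges.toFinset : Set (Sym2 V)) := by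
    intro e he e' he' h
    obtain ⟨d, hd, h1, h2, h3⟩ := hp e (List.mem_toFinset.1 he)
    obtain ⟨d', hd', h1', h2', h3'⟩ := hp e' (List.mem_toFinset.1 he')
    rw [← h1, ← h1', hsnd d hd d' hd' (by rw [h3, h3']; exact h)]
  refine ⟨fun e => (p e).1, fun e => (p e).2, ⟨?_, ?_, ?_⟩, heq, htail, hhead⟩
  · intro e he
    exact SimpleGraph.not_isDiag_of_mem_edgeSet _ (w.edges_subset_edgeSet (List.mem_toFinset.1 he))
  · intro x
    have hsub : w.edges.toFinset.filter (fun e => x ∈ e) ⊆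
        w.edges.toFinset.filter (fun e => (p e).1 = x) ∪ w.edges.toFinset.filter (fun e => (p e).2 = x) := by
      intro e he
      rw [Finset.mem_filter] at he
      have h := he.2
      rw [heq e he.1, Sym2.mem_iff] at h
      simp only [Finset.mem_union, Finset.mem_filter]
      rcases h with h | h
      · exact Or.inl ⟨he.1, h.symm⟩
      · exact Or.inr ⟨he.1, h.symm⟩
    have h1 : (w.edges.toFinset.filter (fun e => (p e).1 = x)).card ≤ 1 := by
      refine Finset.card_le_one.2 fun a ha b hb => ?_
      rw [Finset.mem_filter] at ha hb
      exact htail ha.1 hb.1 (ha.2.trans hb.2.symm)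
    have h2 : (w.edges.toFinset.filter (fun e => (p e).2 = x)).card ≤ 1 := by
      refine Finset.card_le_one.2 fun a ha b hb => ?_
      rw [Finset.mem_filter] at ha hb
      exact hhead ha.1 hb.1 (ha.2.trans hb.2.symm)
    have h3 := (Finset.card_le_card hsub).trans (Finset.card_union_le _ _)
    unfold degree
    omega
  · intro W h1 h2
    have hsupp : ∀ x, x ∈ w.support := fun x => hw.mem_support x
    -- The tour leaves `W` along some dart. Its edge has its tail in `W` but is not inside `W`, so
    -- injectivity of tails leaves room for at most `|W| - 1` inside edges.
    obtain ⟨d, hd, hd1, hd2⟩ := exists_crossing_dart w hsupp h1 h2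
    have hde : d.edge ∈ w.edges := List.mem_map_of_mem hd
    obtain ⟨d', hd', h1', h2', h3'⟩ := hp d.edge hde
    have hnot : d.edge ∉ inside w.edges.toFinset W := by
      intro h
      exact hd2 ((mem_inside.1 h).2 d.snd (Sym2.mem_mk_right d.fst d.snd))
    have hdd : d' = d := by
      have hnd : (w.darts.map SimpleGraph.Dart.edge).Nodup := hcyc.edges_nodup
      exact List.inj_on_of_nodup_map hnd hd' hd h1'
    have hle : (insert d.edge (inside w.edges.toFinset W)).card ≤ W.card := by
      refine Finset.card_le_card_of_injOn (fun e => (p e).1) ?_ (htail.mono ?_)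
      · intro e he
        rw [Finset.mem_coe, Finset.mem_insert] at he
        rcases he with rfl | he
        · show (p d.edge).1 ∈ W
          rw [← h2', hdd]; exact hd1
        · rw [mem_inside] at he
          exact he.2 _ (by
            have h3 := Sym2.mem_mk_left (p e).1 (p e).2
            rwa [← heq e he.1] at h3)
      · intro e he
        rw [Finset.mem_coe, Finset.mem_insert] at he
        rcases he with rfl | he
        · exact List.mem_toFinset.2 hde
        · exact (mem_inside.1 he).1
    rw [Finset.card_insert_of_notMem hnot] at hle
    omega

lemma IsPartialTour.mem_feasible (hn : 3 ≤ Fintype.card V) {F : Finset (Sym2 V)} (hF : IsPartialTour F) :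
    F ∈ feasible V := by
  induction hk : Fintype.card V - F.card generalizing F with
  | zero =>
    exact ⟨F, hF.isTour hn (le_antisymm hF.card_le (by omega)), subset_rfl⟩
  | succ k ih =>
    obtain ⟨e, he, hF'⟩ := hF.exists_insert hn (by omega)
    obtain ⟨A, hA, hsub⟩ := ih hF' (by rw [Finset.card_insert_of_notMem he]; omega)
    exact ⟨A, hA, (Finset.subset_insert _ _).trans hsub⟩

/-- The edges of `O` that a hybrid of `O` and the partial tour `S` retains. -/
def retained (O : Finset (Sym2 V)) (tail head : Sym2 V → V) (S : Finset (Sym2 V)) : Finset (Sym2 V) :=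
  O.filter (fun o => degree S (tail o) = 0 ∧ degree S (head o) < 2)

variable {O S : Finset (Sym2 V)} {tail head : Sym2 V → V}

omit [Fintype V] in
lemma degree_pos {e : Sym2 V} (he : e ∈ S) {v : V} (hv : v ∈ e) : 0 < degree S v :=
  Finset.card_pos.2 ⟨e, Finset.mem_filter.2 ⟨he, hv⟩⟩

lemma IsOrientedTour.tail_mem (h : IsOrientedTour O tail head) {o : Sym2 V} (ho : o ∈ O) : tail o ∈ o := by
  have h1 := Sym2.mem_mk_left (tail o) (head o)
  rwa [← h.eq_mk o ho] at h1

lemma IsOrientedTour.notMem_of_mem_retained (h : IsOrientedTour O tail head) {o : Sym2 V}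
    (ho : o ∈ retained O tail head S) : o ∉ S := by
  intro hS
  rw [retained, Finset.mem_filter] at ho
  have := degree_pos hS (h.tail_mem ho.1)
  omega

omit [Fintype V] in
lemma retained_empty : retained O tail head ∅ = O := by
  simp [retained, degree]

omit [Fintype V] in
lemma retained_anti {S' : Finset (Sym2 V)} (h : S ⊆ S') : retained O tail head S' ⊆ retained O tail head S := by
  intro o
  simp only [retained, Finset.mem_filter]
  rintro ⟨h1, h2, h3⟩
  have := degree_mono h (tail o)
  have := degree_mono h (head o)
  exact ⟨h1, by omega, by omega⟩

/-- A vertex of degree 0, 1 or 2 in `S` receives at most 2, 1 or 0 retained edges. For sparsity,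
split `W` by whether `S` touches a vertex: the edges of `S` are sparse on the touched part, and
retained edges are charged injectively to their tails in the untouched part. -/
lemma IsOrientedTour.isPartialTour_hybrid (h : IsOrientedTour O tail head) (hS : IsPartialTour S) :
    IsPartialTour (S ∪ retained O tail head S) where
  loopless e he := by
    rcases Finset.mem_union.1 he with he | he
    · exact hS.loopless e he
    · exact h.isPartialTour.loopless e (Finset.mem_filter.1 he).1
  degree_le v := by
    have h0 : degree (S ∪ retained O tail head S) v ≤ degree S v + degree (retained O tail head S) v := by
      unfold degree
      rw [Finset.filter_union]
      exact Finset.card_union_le _ _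
    have hsub : (retained O tail head S).filter (fun e => v ∈ e) ⊆
        (retained O tail head S).filter (fun e => tail e = v) ∪
          (retained O tail head S).filter (fun e => head e = v) := by
      intro e he
      rw [Finset.mem_filter] at he
      have h1 := he.2
      rw [h.eq_mk e (Finset.mem_filter.1 he.1).1, Sym2.mem_iff] at h1
      simp only [Finset.mem_union, Finset.mem_filter]
      rcases h1 with h1 | h1
      · exact Or.inl ⟨he.1, h1.symm⟩
      · exact Or.inr ⟨he.1, h1.symm⟩
    have h1 : ((retained O tail head S).filter (fun e => tail e = v)).card ≤ if degree S v = 0 then 1 else 0 := by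
      split_ifs with hv
      · refine Finset.card_le_one.2 fun a ha b hb => ?_
        simp only [retained, Finset.mem_filter] at ha hb
        exact h.tail_inj ha.1.1 hb.1.1 (ha.2.trans hb.2.symm)
      · rw [Nat.le_zero, Finset.card_eq_zero, Finset.filter_eq_empty_iff]
        rintro e he rfl
        exact hv (Finset.mem_filter.1 he).2.1
    have h2 : ((retained O tail head S).filter (fun e => head e = v)).card ≤ if degree S v < 2 then 1 else 0 := by
      split_ifs with hv
      · refine Finset.card_le_one.2 fun a ha b hb => ?_
        simp only [retained, Finset.mem_filter] at ha hb
        exact h.head_inj ha.1.1 hb.1.1 (ha.2.trans hb.2.symm)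
      · rw [Nat.le_zero, Finset.card_eq_zero, Finset.filter_eq_empty_iff]
        rintro e he rfl
        exact hv (Finset.mem_filter.1 he).2.2
    have h3 : degree (retained O tail head S) v ≤ _ := (Finset.card_le_card hsub).trans (Finset.card_union_le _ _)
    have := hS.degree_le v
    split_ifs at h1 h2 <;> omega
  sparse W hW1 hW2 := by
    have h0 : (inside (S ∪ retained O tail head S) W).card ≤
        (inside S W).card + (inside (retained O tail head S) W).card := by
      unfold inside
      rw [Finset.filter_union]
      exact Finset.card_union_le _ _
    by_cases hT : (W.filter (fun v => degree S v ≠ 0)).Nonempty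
    · have h1 : inside S W ⊆ inside S (W.filter (fun v => degree S v ≠ 0)) := by
        intro e he
        rw [mem_inside] at he ⊢
        exact ⟨he.1, fun v hv => Finset.mem_filter.2 ⟨he.2 v hv, (degree_pos he.1 hv).ne'⟩⟩
      have h2 := hS.sparse _ hT (fun h => hW2 (Finset.eq_univ_of_forall fun x =>
        (Finset.mem_filter.1 (h ▸ Finset.mem_univ x)).1))
      have h3 : (inside (retained O tail head S) W).card ≤ (W.filter (fun v => ¬ degree S v ≠ 0)).card := by
        refine Finset.card_le_card_of_injOn tail ?_ (h.tail_inj.mono ?_)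
        · intro e he
          rw [Finset.mem_coe, mem_inside, retained, Finset.mem_filter] at he
          rw [Finset.mem_coe, Finset.mem_filter]
          exact ⟨he.2 _ (h.tail_mem he.1.1), by simp [he.1.2.1]⟩
        · intro e he
          exact (Finset.mem_filter.1 (mem_inside.1 he).1).1
      have h4 := Finset.card_filter_add_card_filter_not (s := W) (fun v => degree S v ≠ 0)
      have := Finset.card_le_card h1
      omega
    · have h1 : inside S W = ∅ := by
        rw [Finset.eq_empty_iff_forall_notMem]
        intro e he
        rw [mem_inside] at he
        exact hT ⟨e.out.1, Finset.mem_filter.2 ⟨he.2 _ e.out_fst_mem, (degree_pos he.1 e.out_fst_mem).ne'⟩⟩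
      have h2 := h.isPartialTour.sparse W hW1 hW2
      have h3 : (inside (retained O tail head S) W).card ≤ (inside O W).card :=
        Finset.card_le_card (inside_mono (Finset.filter_subset _ O) W)
      rw [h1, Finset.card_empty] at h0
      omega

/-- Charge a lost edge to its tail if that lies on `e`, otherwise to its head. A vertex charged as a
tail has degree 0 in `S`, one charged as a head has degree 1, so no end point of `e` is charged
twice. -/
lemma IsOrientedTour.card_retained_sdiff_le (h : IsOrientedTour O tail head) {e : Sym2 V} (he : e ∉ S) :
    (retained O tail head S \ retained O tail head (insert e S)).card ≤ 2 := by
  have hφ : (retained O tail head S \ retained O tail head (insert e S)).card ≤ e.toFinset.card := by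
    refine Finset.card_le_card_of_injOn (fun o => if tail o ∈ e then tail o else head o) ?_ ?_
    · intro o ho
      simp only [Finset.coe_sdiff, Set.mem_sdiff, Finset.mem_coe, retained, Finset.mem_filter, degree_insert he] at ho
      simp only [Finset.mem_coe, Sym2.mem_toFinset]
      split_ifs at ho ⊢ with h1 h2 <;> first | assumption | grind
    · intro o ho o' ho'
      simp only [Finset.coe_sdiff, Set.mem_sdiff, Finset.mem_coe, retained, Finset.mem_filter, degree_insert he] at ho ho'
      have h1 := h.tail_inj ho.1.1 ho'.1.1
      have h2 := h.head_inj ho.1.1 ho'.1.1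
      dsimp only
      split_ifs at ho ho' ⊢ with a1 a2 a3 a4 a5 <;> grind
  have : e.toFinset.card ≤ 2 := by
    induction e with | _ a b =>
    rw [Sym2.toFinset_mk_eq]; exact Finset.card_le_two
  omega

end Orientation

/-! ### Analysis of a greedy run -/

section Greedy

variable {V : Type*} [Fintype V] [DecidableEq V]

lemma mem_allEdges {e : Sym2 V} : e ∈ allEdges V ↔ ¬ e.IsDiag := by
  simp [allEdges]

lemma exists_greedyRun (h : Finset (Sym2 V) → ℝ) {R S : Finset (Sym2 V)} (c : ℝ) (hRS : Disjoint R S) :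
    ∃ S' c', GreedyRun h R S c S' c' := by
  induction hk : R.card generalizing R S c with
  | zero => exact ⟨S, c, .halt (by simp [Finset.card_eq_zero.1 hk])⟩
  | succ k ih =>
    by_cases hloop : R ≠ ∅ ∧ S.card ≤ Fintype.card V
    · have hsd : R \ S = R := Finset.sdiff_eq_self_of_disjoint hRS
      obtain ⟨e, he, hmax⟩ := Finset.exists_max_image (R \ S) (fun e => h (insert e S) - h S)
        (by rw [hsd]; exact Finset.nonempty_iff_ne_empty.2 hloop.1)
      have heR : e ∈ R := (Finset.mem_sdiff.1 he).1
      have hcard : (R.erase e).card = k := by rw [Finset.card_erase_of_mem heR, hk]; rfl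
      by_cases hadm : Admissible S e
      · obtain ⟨S', c', hrun⟩ := ih (R := R.erase e) (S := insert e S) (h (insert e S))
          (by rw [Finset.disjoint_insert_right]
              exact ⟨Finset.notMem_erase e R, hRS.mono_left (Finset.erase_subset e R)⟩) hcard
        exact ⟨S', c', .accept hloop ⟨he, hmax⟩ hadm hrun⟩
      · obtain ⟨S', c', hrun⟩ := ih (R := R.erase e) (S := S) c (hRS.mono_left (Finset.erase_subset e R)) hcard
        exact ⟨S', c', .reject hloop ⟨he, hmax⟩ hadm hrun⟩
    · exact ⟨S, c, .halt hloop⟩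

/-- The state of the inner loop: remaining edges `R` and chosen edges `S`; every discarded edge is blocked by `S`. -/
structure GreedyState (R S : Finset (Sym2 V)) : Prop where
  isPartialTour : IsPartialTour S
  disjoint : Disjoint R S
  subset : R ⊆ allEdges V
  blocked : ∀ e, ¬ e.IsDiag → e ∉ R → e ∉ S → ¬ IsPartialTour (insert e S)

lemma greedyState_init : GreedyState (allEdges V) ∅ where
  isPartialTour := isPartialTour_empty
  disjoint := by simp
  subset := subset_rfl
  blocked e h1 h2 := absurd (mem_allEdges.2 h1) h2

variable {R S : Finset (Sym2 V)} {e : Sym2 V}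

lemma GreedyState.accept (hs : GreedyState R S) (he : e ∈ R \ S) (hadm : Admissible S e) :
    GreedyState (R.erase e) (insert e S) where
  isPartialTour :=
    (admissible_iff hs.isPartialTour (Finset.mem_sdiff.1 he).2
      (mem_allEdges.1 (hs.subset (Finset.mem_sdiff.1 he).1))).1 hadm
  disjoint := by
    rw [Finset.disjoint_insert_right]
    exact ⟨Finset.notMem_erase e R, hs.disjoint.mono_left (Finset.erase_subset e R)⟩
  subset := (Finset.erase_subset e R).trans hs.subset
  blocked o h1 h2 h3 h4 := by
    rw [Finset.mem_insert, not_or] at h3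
    exact hs.blocked o h1 (fun h => h2 (Finset.mem_erase.2 ⟨h3.1, h⟩)) h3.2
      (h4.mono (Finset.insert_subset_insert _ (Finset.subset_insert _ _)))

lemma GreedyState.reject (hs : GreedyState R S) (he : e ∈ R \ S) (hadm : ¬ Admissible S e) :
    GreedyState (R.erase e) S where
  isPartialTour := hs.isPartialTour
  disjoint := hs.disjoint.mono_left (Finset.erase_subset e R)
  subset := (Finset.erase_subset e R).trans hs.subset
  blocked o h1 h2 h3 := by
    by_cases hoe : o = e
    · subst hoe
      exact fun h => hadm ((admissible_iff hs.isPartialTour h3 h1).2 h)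
    · exact hs.blocked o h1 (fun h => h2 (Finset.mem_erase.2 ⟨hoe, h⟩)) h3

/-- Partial tours never exceed `n` edges, so the loop stops only when no edges remain. Every edge
outside `S` is then blocked, and a blocked partial tour is complete. -/
lemma GreedyState.card_eq (hs : GreedyState R S) (hn : 3 ≤ Fintype.card V)
    (hend : ¬ (R ≠ ∅ ∧ S.card ≤ Fintype.card V)) : S.card = Fintype.card V := by
  have h1 := hs.isPartialTour.card_le
  by_contra hne
  obtain ⟨e, he, hp⟩ := hs.isPartialTour.exists_insert hn (by omega)
  have hR : R = ∅ := by
    by_contra hR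
    exact hend ⟨hR, h1⟩
  exact hs.blocked e (hp.loopless e (Finset.mem_insert_self _ _)) (by simp [hR]) he hp

lemma GreedyRun.isPartialTour_and_card (hn : 3 ≤ Fintype.card V) {h : Finset (Sym2 V) → ℝ} {S' : Finset (Sym2 V)}
    {c c' : ℝ} (hrun : GreedyRun h R S c S' c') (hs : GreedyState R S) :
    IsPartialTour S' ∧ S'.card = Fintype.card V ∧ (c' = h S' ∨ (S' = S ∧ c' = c)) := by
  induction hrun with
  | halt hend => exact ⟨hs.isPartialTour, hs.card_eq hn hend, Or.inr ⟨rfl, rfl⟩⟩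
  | accept hloop hchoice hadm hrest ih =>
    obtain ⟨h1, h2, h3⟩ := ih (hs.accept hchoice.1 hadm)
    refine ⟨h1, h2, Or.inl ?_⟩
    rcases h3 with h3 | ⟨h3, h4⟩
    · exact h3
    · rw [h4, h3]
  | reject hloop hchoice hadm hrest ih => exact ih (hs.reject hchoice.1 hadm)

lemma GreedyRun.isTour_and_value (hn : 3 ≤ Fintype.card V) {h : Finset (Sym2 V) → ℝ} {S' : Finset (Sym2 V)}
    {c c' : ℝ} (hrun : GreedyRun h (allEdges V) ∅ c S' c') : IsTour S' ∧ c' = h S' := by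
  obtain ⟨h1, h2, h3⟩ := hrun.isPartialTour_and_card hn greedyState_init
  refine ⟨h1.isTour hn h2, h3.resolve_right ?_⟩
  rintro ⟨rfl, -⟩
  simp at h2
  omega

/-- Monotone submodular set functions. -/
structure IsMonoSubmodular {E : Type*} [DecidableEq E] (h : Finset E → ℝ) : Prop where
  mono : ∀ A B, A ⊆ B → h A ≤ h B
  submod : ∀ A B, A ⊆ B → ∀ e, h (insert e B) - h B ≤ h (insert e A) - h A

lemma IsMonoSubmodular.le_add_card_mul {E : Type*} [DecidableEq E] {h : Finset E → ℝ} (hh : IsMonoSubmodular h)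
    {X Y Z : Finset E} (hYX : Y ⊆ X) {ρ : ℝ} (hρ : ∀ o ∈ Z, h (insert o Y) - h Y ≤ ρ) :
    h (X ∪ Z) ≤ h X + Z.card * ρ := by
  induction Z using Finset.induction_on with
  | empty => simp
  | insert a Z ha ih =>
    have h1 := ih fun o ho => hρ o (Finset.mem_insert_of_mem ho)
    have h2 := hh.submod Y (X ∪ Z) (hYX.trans Finset.subset_union_left) a
    have h3 := hρ a (Finset.mem_insert_self _ _)
    rw [Finset.union_insert, Finset.card_insert_of_notMem ha]
    push_cast
    linarith

/-- Induction on the run, with the value of the hybrid as potential. The slack `err` is there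
because the curvature of the true `H` bounds marginals of the sampled function only approximately.
-/
lemma GreedyRun.hybrid_le (hn : 3 ≤ Fintype.card V) {h : Finset (Sym2 V) → ℝ} (hh : IsMonoSubmodular h)
    {κ err : ℝ} (hκ1 : κ ≤ 1)
    (hcurv : ∀ A, IsPartialTour A → ∀ e ∈ A, (1 - κ) * (h {e} - h ∅) - err ≤ h A - h (A.erase e))
    {O : Finset (Sym2 V)} {tail head : Sym2 V → V} (hO : IsOrientedTour O tail head)
    {S' : Finset (Sym2 V)} {c c' : ℝ} (hrun : GreedyRun h R S c S' c') (hs : GreedyState R S) :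
    h (S ∪ retained O tail head S) ≤ h S' + (1 + κ) * (h S' - h S) + (S'.card - S.card) * err := by
  induction hrun with
  | @halt R S c hend =>
    have h1 := hs.card_eq hn hend
    have h2 := (hO.isPartialTour_hybrid hs.isPartialTour).card_le
    have h3 := Finset.eq_of_subset_of_card_le
      (Finset.subset_union_left : S ⊆ S ∪ retained O tail head S) (by omega)
    rw [← h3]; simp
  | @accept R S S' c c' e hloop hchoice hadm hrest ih =>
    have hs' := hs.accept hchoice.1 hadm
    have ih := ih hs'
    obtain ⟨heRS, hmax⟩ := hchoice
    obtain ⟨heR, heS⟩ := Finset.mem_sdiff.1 heRS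
    set D := retained O tail head S with hD
    set D' := retained O tail head (insert e S) with hD'
    have hA' : IsPartialTour (insert e S ∪ D') := hO.isPartialTour_hybrid hs'.isPartialTour
    have heD' : e ∉ D' := fun hmem => hO.notMem_of_mem_retained hmem (Finset.mem_insert_self _ _)
    have hDD : D' ⊆ D := retained_anti (Finset.subset_insert _ _)
    have herase : (insert e S ∪ D').erase e = S ∪ D' := by
      ext x
      simp only [Finset.mem_erase, Finset.mem_union, Finset.mem_insert]
      constructor
      · tauto
      · rintro (hx | hx)
        · exact ⟨fun hxe => heS (hxe ▸ hx), Or.inl (Or.inr hx)⟩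
        · exact ⟨fun hxe => heD' (hxe ▸ hx), Or.inr hx⟩
    have h1 := hcurv _ hA' e (by simp)
    rw [herase] at h1
    have h2 : h (S ∪ D) ≤ h (S ∪ D') + (D \ D').card * (h (insert e S) - h S) := by
      have h3 : S ∪ D = (S ∪ D') ∪ (D \ D') := by
        rw [Finset.union_assoc, Finset.union_sdiff_of_subset hDD]
      rw [h3]
      refine hh.le_add_card_mul Finset.subset_union_left fun o ho => hmax o ?_
      have hoD := (Finset.mem_sdiff.1 ho).1
      have hoS : o ∉ S := hO.notMem_of_mem_retained hoD
      have hpt : IsPartialTour (insert o S) :=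
        (hO.isPartialTour_hybrid hs.isPartialTour).mono
          (Finset.insert_subset (Finset.mem_union_right _ hoD) Finset.subset_union_left)
      rw [Finset.mem_sdiff]
      refine ⟨?_, hoS⟩
      by_contra hoR
      exact hs.blocked o (hpt.loopless o (Finset.mem_insert_self _ _)) hoR hoS hpt
    -- The gain `ρ` of the step is at most the gain of `e` at the empty set, so curvature regains at
    -- least `(1 - κ)ρ - err` of the loss `2ρ`.
    have hρ : 0 ≤ h (insert e S) - h S := sub_nonneg.2 (hh.mono _ _ (Finset.subset_insert _ _))
    have hc2 : ((D \ D').card : ℝ) ≤ 2 := by exact_mod_cast hO.card_retained_sdiff_le heS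
    have h3 : h (insert e S) - h S ≤ h {e} - h ∅ := hh.submod ∅ S (Finset.empty_subset _) e
    rw [Finset.card_insert_of_notMem heS] at ih
    push_cast at ih
    nlinarith [mul_le_mul_of_nonneg_right hc2 hρ, mul_le_mul_of_nonneg_left h3 (sub_nonneg.2 hκ1)]
  | reject hloop hchoice hadm hrest ih => exact ih (hs.reject hchoice.1 hadm)

/-- The greedy tour is a `1 / (2 + κ)` approximation up to `err` per edge. -/
lemma GreedyRun.tour_le (hn : 3 ≤ Fintype.card V) {h : Finset (Sym2 V) → ℝ} (hh : IsMonoSubmodular h)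
    {κ err : ℝ} (hκ1 : κ ≤ 1)
    (hcurv : ∀ A, IsPartialTour A → ∀ e ∈ A, (1 - κ) * (h {e} - h ∅) - err ≤ h A - h (A.erase e))
    {O : Finset (Sym2 V)} (hO : O ∈ feasible V)
    {S' : Finset (Sym2 V)} {c c' : ℝ} (hrun : GreedyRun h (allEdges V) ∅ c S' c') :
    h O ≤ h S' + (1 + κ) * (h S' - h ∅) + Fintype.card V * err := by
  obtain ⟨A, hA, hOA⟩ := hO
  obtain ⟨tail, head, hor⟩ := hA.exists_orientation
  have h1 := hrun.hybrid_le hn hh hκ1 hcurv hor greedyState_init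
  rw [retained_empty, Finset.empty_union, (hrun.isPartialTour_and_card hn greedyState_init).2.1] at h1
  have := hh.mono _ _ hOA
  simp at h1
  linarith

end Greedy

/-! ### Signed sums of monotone functions -/

section SignSums

/-- The sign `±1` encoded by a Boolean. -/
def sign (b : Bool) : ℝ := if b then 1 else -1

lemma sign_not (b : Bool) : sign (!b) = -sign b := by cases b <;> simp [sign]

/-- The largest partial sum of a sequence of signs, by Lindley's recursion. -/
noncomputable def prefixMax : (n : ℕ) → (Fin n → Bool) → ℝ
  | 0, _ => 0
  | n + 1, σ => max 0 (sign (σ 0) + prefixMax n (fun j => σ j.succ))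

/-- Summation by parts: nonincreasing nonnegative weights are nonnegative combinations of indicators
of initial segments. In the induction the first weight serves as the bound for the others. -/
lemma sum_sign_mul_le : ∀ (n : ℕ) (σ : Fin n → Bool) (v : Fin n → ℝ) (B : ℝ), Antitone v → (∀ j, 0 ≤ v j) →
    (∀ j, v j ≤ B) → 0 ≤ B → ∑ j, sign (σ j) * v j ≤ B * prefixMax n σ
  | 0, _, _, _, _, _, _, _ => by simp [prefixMax]
  | n + 1, σ, v, B, hv, h0, hB, hB0 => by
    rw [Fin.sum_univ_succ, prefixMax]
    have ih := sum_sign_mul_le n (fun j => σ j.succ) (fun j => v j.succ) (v 0)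
      (fun i j hij => hv (Fin.succ_le_succ_iff.2 hij)) (fun j => h0 _) (fun j => hv (Fin.zero_le _)) (h0 0)
    set p := prefixMax n fun j => σ j.succ
    calc sign (σ 0) * v 0 + ∑ j : Fin n, sign (σ j.succ) * v j.succ ≤ v 0 * (sign (σ 0) + p) := by linarith
      _ ≤ v 0 * max 0 (sign (σ 0) + p) := mul_le_mul_of_nonneg_left (le_max_right _ _) (h0 0)
      _ ≤ B * max 0 (sign (σ 0) + p) := mul_le_mul_of_nonneg_right (hB 0) (le_max_left _ _)

/-- Clipping at zero can only decrease `cosh`, and averaging `cosh (t(±1 + p))` over the sign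
cancels the `sinh` terms, leaving a factor `cosh t` per step. This replaces a reflection argument.
-/
lemma sum_cosh_prefixMax_le (t : ℝ) : ∀ n : ℕ,
    ∑ σ : Fin n → Bool, Real.cosh (t * prefixMax n σ) ≤ (2 * Real.cosh t) ^ n
  | 0 => by simp [prefixMax]
  | n + 1 => by
    have hstep : ∀ x : ℝ, Real.cosh (t * max 0 x) ≤ Real.cosh (t * x) := by
      intro x
      rcases le_total 0 x with h | h
      · rw [max_eq_right h]
      · rw [max_eq_left h, mul_zero, Real.cosh_zero]
        exact Real.one_le_cosh _
    calc ∑ σ : Fin (n + 1) → Bool, Real.cosh (t * prefixMax (n + 1) σ)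
        = ∑ p : Bool × (Fin n → Bool), Real.cosh (t * prefixMax (n + 1) (Fin.cons p.1 p.2)) :=
          (Equiv.sum_comp (Fin.consEquiv fun _ => Bool) _).symm
      _ = ∑ b : Bool, ∑ σ : Fin n → Bool, Real.cosh (t * prefixMax (n + 1) (Fin.cons b σ)) :=
          Fintype.sum_prod_type _
      _ ≤ ∑ b : Bool, ∑ σ : Fin n → Bool, Real.cosh (t * (sign b + prefixMax n σ)) := by
          refine Finset.sum_le_sum fun b _ => Finset.sum_le_sum fun σ _ => ?_
          simpa [prefixMax] using hstep (sign b + prefixMax n σ)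
      _ = 2 * Real.cosh t * ∑ σ : Fin n → Bool, Real.cosh (t * prefixMax n σ) := by
          rw [Fintype.sum_bool, ← Finset.sum_add_distrib, Finset.mul_sum]
          refine Finset.sum_congr rfl fun σ _ => ?_
          simp only [sign, if_true, Bool.false_eq_true, if_false, mul_add, mul_one, mul_neg, Real.cosh_add,
            Real.cosh_neg, Real.sinh_neg]
          ring
      _ ≤ 2 * Real.cosh t * (2 * Real.cosh t) ^ n :=
          mul_le_mul_of_nonneg_left (sum_cosh_prefixMax_le t n) (by have := Real.cosh_pos t; positivity)
      _ = (2 * Real.cosh t) ^ (n + 1) := by ring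

lemma sum_exp_prefixMax_le (t : ℝ) (n : ℕ) :
    ∑ σ : Fin n → Bool, Real.exp (t * prefixMax n σ) ≤ 2 * 2 ^ n * Real.exp (t ^ 2 * n / 2) := by
  have h1 : ∀ x : ℝ, Real.exp x ≤ 2 * Real.cosh x := by
    intro x
    rw [Real.cosh_eq]
    have := Real.exp_pos (-x)
    linarith
  calc ∑ σ : Fin n → Bool, Real.exp (t * prefixMax n σ)
      ≤ ∑ σ : Fin n → Bool, 2 * Real.cosh (t * prefixMax n σ) := Finset.sum_le_sum fun σ _ => h1 _
    _ = 2 * ∑ σ : Fin n → Bool, Real.cosh (t * prefixMax n σ) := by rw [Finset.mul_sum]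
    _ ≤ 2 * (2 * Real.cosh t) ^ n := by linarith [sum_cosh_prefixMax_le t n]
    _ = 2 * 2 ^ n * Real.cosh t ^ n := by ring
    _ ≤ 2 * 2 ^ n * Real.exp (t ^ 2 / 2) ^ n := by
        have := Real.cosh_pos t
        gcongr
        exact Real.cosh_le_exp_half_sq t
    _ = 2 * 2 ^ n * Real.exp (t ^ 2 * n / 2) := by
        rw [← Real.exp_nat_mul]; ring_nf

/-- For every sample, the signed sums of the functions `v i` have a common subgaussian majorant. -/
def SignBounded {ι Y : Type*} (v : ι → Y → ℝ) : Prop :=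
  ∀ (n : ℕ) (y : Fin n → Y), ∃ W : (Fin n → Bool) → ℝ, (∀ σ i, ∑ j, sign (σ j) * v i (y j) ≤ W σ) ∧
    ∀ t : ℝ, ∑ σ, Real.exp (t * W σ) ≤ 2 * 2 ^ n * Real.exp (t ^ 2 * n / 2)

/-- Sorting the sample by decreasing `X` makes all the functions nonincreasing at once, so one
majorant serves every index. The ordering does not depend on the signs, whose uniform distribution
is invariant under permutation. -/
lemma signBounded_of_monotone {ι Y : Type*} (X : Y → ℝ) (u : ι → ℝ → ℝ) (hu : ∀ i, Monotone (u i))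
    (h0 : ∀ i x, 0 ≤ u i x) (h1 : ∀ i x, u i x ≤ 1) : SignBounded (fun i y => u i (X y)) := by
  intro n y
  set π := Tuple.sort fun j => -X (y j) with hπ
  have hsort : Monotone ((fun j => -X (y j)) ∘ π) := Tuple.monotone_sort _
  refine ⟨fun σ => prefixMax n (σ ∘ π), fun σ i => ?_, fun t => ?_⟩
  · rw [← Equiv.sum_comp π]
    have := sum_sign_mul_le n (σ ∘ π) (fun j => u i (X (y (π j)))) 1
      (fun a b hab => hu i (neg_le_neg_iff.1 (hsort hab))) (fun _ => h0 _ _) (fun _ => h1 _ _) zero_le_one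
    simpa using this
  · refine le_trans (le_of_eq ?_) (sum_exp_prefixMax_le t n)
    exact Equiv.sum_comp (Equiv.arrowCongr π.symm (Equiv.refl Bool)) fun σ => Real.exp (t * prefixMax n σ)

lemma SignBounded.neg {ι Y : Type*} {v : ι → Y → ℝ} (hv : SignBounded v) : SignBounded (fun i y => -v i y) := by
  intro n y
  obtain ⟨W, h1, h2⟩ := hv n y
  refine ⟨fun σ => W (fun j => !σ j), fun σ i => ?_, fun t => ?_⟩
  · refine le_trans (le_of_eq ?_) (h1 (fun j => !σ j) i)
    refine Finset.sum_congr rfl fun j _ => ?_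
    rw [sign_not]; ring
  · refine le_trans (le_of_eq ?_) (h2 t)
    exact Equiv.sum_comp (Equiv.arrowCongr (Equiv.refl (Fin n)) Equiv.boolNot) fun σ => Real.exp (t * W σ)

end SignSums

/-! ### Uniform deviations by symmetrization -/

section Concentration

variable {ι Y : Type*} [MeasurableSpace Y] (μ : Measure Y) [IsProbabilityMeasure μ]

/-- Exchanges the members of a pair according to a sign. -/
def swapIf {Y : Type*} (b : Bool) (p : Y × Y) : Y × Y := if b then p else p.swap

lemma measurePreserving_swapIf (b : Bool) : MeasurePreserving (swapIf b) (μ.prod μ) (μ.prod μ) := by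
  cases b
  · exact Measure.measurePreserving_swap
  · exact MeasurePreserving.id _

omit [MeasurableSpace Y] in
lemma sub_swapIf (b : Bool) (p : Y × Y) (v : Y → ℝ) :
    v (swapIf b p).1 - v (swapIf b p).2 = sign b * v p.1 + sign (!b) * v p.2 := by
  cases b <;> simp [swapIf, sign] <;> ring

/-- Jensen's inequality, which replaces the mean by an independent ghost sample; it is proved by
integrating the tangent line of `exp` at the mean. -/
lemma exp_sub_mean_le_lintegral {v : Y → ℝ} (hm : Measurable v) (hb : ∀ y, |v y| ≤ 1) (n : ℕ) (s A : ℝ) :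
    ENNReal.ofReal (Real.exp (s * (A - n * ∫ y, v y ∂μ))) ≤
      ∫⁻ y : Fin n → Y, ENNReal.ofReal (Real.exp (s * (A - ∑ j, v (y j)))) ∂Measure.pi fun _ => μ := by
  have hmS : Measurable fun y : Fin n → Y => ∑ j, v (y j) :=
    Finset.measurable_sum _ fun j _ => hm.comp (measurable_pi_apply j)
  have hbS : ∀ y : Fin n → Y, |∑ j, v (y j)| ≤ n := fun y =>
    (Finset.abs_sum_le_sum_abs _ _).trans ((Finset.sum_le_sum fun j _ => hb (y j)).trans (by simp))
  have hiS : Integrable (fun y : Fin n → Y => ∑ j, v (y j)) (Measure.pi fun _ => μ) :=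
    Integrable.of_bound hmS.aestronglyMeasurable n (Filter.Eventually.of_forall hbS)
  have hiv : ∀ j : Fin n, Integrable (fun y : Fin n → Y => v (y j)) (Measure.pi fun _ => μ) := fun j =>
    Integrable.of_bound (hm.comp (measurable_pi_apply j)).aestronglyMeasurable 1
      (Filter.Eventually.of_forall fun y => hb (y j))
  have hmean : ∫ y : Fin n → Y, ∑ j, v (y j) ∂(Measure.pi fun _ => μ) = n * ∫ y, v y ∂μ := by
    rw [integral_finsetSum _ fun j _ => hiv j]
    simp_rw [integral_comp_eval (μ := fun _ : Fin n => μ) hm.aestronglyMeasurable]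
    simp
  have hie : Integrable (fun y : Fin n → Y => Real.exp (s * (A - ∑ j, v (y j)))) (Measure.pi fun _ => μ) := by
    refine Integrable.of_bound (Measurable.aestronglyMeasurable (by fun_prop)) (Real.exp (|s| * (|A| + n))) (Filter.Eventually.of_forall fun y => ?_)
    rw [Real.norm_eq_abs, abs_of_pos (Real.exp_pos _), Real.exp_le_exp]
    refine (le_abs_self _).trans ?_
    rw [abs_mul]
    gcongr
    exact (abs_sub _ _).trans (by gcongr; exact hbS y)
  rw [← ofReal_integral_eq_lintegral_ofReal hie (Filter.Eventually.of_forall fun _ => (Real.exp_pos _).le)]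
  refine ENNReal.ofReal_le_ofReal ?_
  set m := (n : ℝ) * ∫ y, v y ∂μ with hmdef
  set c := Real.exp (s * (A - m)) with hc
  have hlin : ∀ y : Fin n → Y, c + (c * s) * (m - ∑ j, v (y j)) ≤ Real.exp (s * (A - ∑ j, v (y j))) := by
    intro y
    have h1 : s * (A - ∑ j, v (y j)) = s * (A - m) + s * (m - ∑ j, v (y j)) := by ring
    rw [h1, Real.exp_add, ← hc]
    have h2 := Real.add_one_le_exp (s * (m - ∑ j, v (y j)))
    nlinarith [Real.exp_pos (s * (A - m))]
  have hisub : Integrable (fun y : Fin n → Y => m - ∑ j, v (y j)) (Measure.pi fun _ => μ) :=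
    (integrable_const _).sub hiS
  calc c = ∫ y : Fin n → Y, (c + (c * s) * (m - ∑ j, v (y j))) ∂(Measure.pi fun _ => μ) := by
        rw [integral_add (integrable_const _) (hisub.const_mul _), integral_const_mul,
          integral_sub (integrable_const _) hiS, hmean]
        simp
    _ ≤ _ := integral_mono ((integrable_const _).add (hisub.const_mul _)) hie hlin

/-- Swapping the members of each pair preserves the product law, so the integrand may be averaged
over all sign patterns. The two halves of the sample are decoupled by `exp (a + b) ≤ (exp (2a) + exp
(2b)) / 2`. -/
lemma lintegral_symmetrized_le [Countable ι] {v : ι → Y → ℝ} (hm : ∀ i, Measurable (v i)) (hv : SignBounded v)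
    (n : ℕ) {s : ℝ} (hs : 0 ≤ s) :
    ∫⁻ p : (Fin n → Y) × (Fin n → Y), ⨆ i, ENNReal.ofReal (Real.exp (s * (∑ j, v i (p.1 j) - ∑ j, v i (p.2 j))))
      ∂((Measure.pi fun _ => μ).prod (Measure.pi fun _ => μ)) ≤ ENNReal.ofReal (2 * Real.exp (2 * s ^ 2 * n)) := by
  set G : (Fin n → Y × Y) → ENNReal := fun z =>
    ⨆ i, ENNReal.ofReal (Real.exp (s * ∑ j, (v i (z j).1 - v i (z j).2))) with hG
  have hGm : Measurable G := by
    refine Measurable.iSup fun i => ?_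
    have := hm i
    fun_prop
  have hmp := measurePreserving_arrowProdEquivProdArrow Y Y (Fin n) (fun _ => μ) (fun _ => μ)
  have h1 : ∫⁻ p : (Fin n → Y) × (Fin n → Y),
      ⨆ i, ENNReal.ofReal (Real.exp (s * (∑ j, v i (p.1 j) - ∑ j, v i (p.2 j))))
      ∂((Measure.pi fun _ => μ).prod (Measure.pi fun _ => μ)) =
      ∫⁻ z, G z ∂(Measure.pi fun _ : Fin n => μ.prod μ) := by
    rw [← hmp.lintegral_comp_emb (MeasurableEquiv.measurableEmbedding _)]
    refine lintegral_congr fun z => ?_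
    simp only [hG, Finset.sum_sub_distrib]
    rfl
  have h2 : ∀ σ : Fin n → Bool, ∫⁻ z, G (fun j => swapIf (σ j) (z j)) ∂(Measure.pi fun _ : Fin n => μ.prod μ) =
      ∫⁻ z, G z ∂(Measure.pi fun _ : Fin n => μ.prod μ) := fun σ =>
    (measurePreserving_pi (fun _ : Fin n => μ.prod μ) (fun _ => μ.prod μ)
      (fun j => measurePreserving_swapIf μ (σ j))).lintegral_comp hGm
  have h3 : ∀ z : Fin n → Y × Y, ∑ σ : Fin n → Bool, G (fun j => swapIf (σ j) (z j)) ≤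
      ENNReal.ofReal (2 ^ n * (2 * Real.exp (2 * s ^ 2 * n))) := by
    intro z
    obtain ⟨W₁, hW₁, hE₁⟩ := hv n fun j => (z j).1
    obtain ⟨W₂, hW₂, hE₂⟩ := hv n fun j => (z j).2
    have hle : ∀ σ : Fin n → Bool, G (fun j => swapIf (σ j) (z j)) ≤
        ENNReal.ofReal ((Real.exp (2 * s * W₁ σ) + Real.exp (2 * s * W₂ (fun j => !σ j))) / 2) := by
      intro σ
      refine iSup_le fun i => ENNReal.ofReal_le_ofReal ?_
      simp only [sub_swapIf, Finset.sum_add_distrib]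
      have a1 := hW₁ σ i
      have a2 := hW₂ (fun j => !σ j) i
      calc Real.exp (s * (∑ j, sign (σ j) * v i (z j).1 + ∑ j, sign (!σ j) * v i (z j).2))
          ≤ Real.exp (s * W₁ σ + s * W₂ (fun j => !σ j)) := by
            rw [Real.exp_le_exp, ← mul_add]
            exact mul_le_mul_of_nonneg_left (add_le_add a1 a2) hs
        _ ≤ _ := by
            rw [Real.exp_add, mul_assoc, mul_assoc, two_mul, two_mul, Real.exp_add, Real.exp_add]
            nlinarith [sq_nonneg (Real.exp (s * W₁ σ) - Real.exp (s * W₂ (fun j => !σ j)))]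
    calc ∑ σ : Fin n → Bool, G (fun j => swapIf (σ j) (z j))
        ≤ ∑ σ : Fin n → Bool,
          ENNReal.ofReal ((Real.exp (2 * s * W₁ σ) + Real.exp (2 * s * W₂ (fun j => !σ j))) / 2) :=
          Finset.sum_le_sum fun σ _ => hle σ
      _ = ENNReal.ofReal (∑ σ : Fin n → Bool,
          (Real.exp (2 * s * W₁ σ) + Real.exp (2 * s * W₂ (fun j => !σ j))) / 2) :=
          (ENNReal.ofReal_sum_of_nonneg fun σ _ => by positivity).symm
      _ ≤ _ := by
          refine ENNReal.ofReal_le_ofReal ?_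
          have h4 : ∑ σ : Fin n → Bool, Real.exp (2 * s * W₂ (fun j => !σ j)) =
              ∑ σ : Fin n → Bool, Real.exp (2 * s * W₂ σ) :=
            Equiv.sum_comp (Equiv.arrowCongr (Equiv.refl (Fin n)) Equiv.boolNot)
              fun σ => Real.exp (2 * s * W₂ σ)
          rw [← Finset.sum_div, Finset.sum_add_distrib, h4]
          have h5 := hE₁ (2 * s)
          have h6 := hE₂ (2 * s)
          have h7 : (2 * s) ^ 2 * n / 2 = 2 * s ^ 2 * n := by ring
          rw [h7] at h5 h6
          linarith
  rw [h1]
  have h4 : (2 : ENNReal) ^ n * ∫⁻ z, G z ∂(Measure.pi fun _ : Fin n => μ.prod μ) ≤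
      2 ^ n * ENNReal.ofReal (2 * Real.exp (2 * s ^ 2 * n)) := by
    calc (2 : ENNReal) ^ n * ∫⁻ z, G z ∂(Measure.pi fun _ : Fin n => μ.prod μ)
        = ∑ σ : Fin n → Bool, ∫⁻ z, G (fun j => swapIf (σ j) (z j)) ∂(Measure.pi fun _ : Fin n => μ.prod μ) := by
          simp [h2]
      _ = ∫⁻ z, ∑ σ : Fin n → Bool, G (fun j => swapIf (σ j) (z j)) ∂(Measure.pi fun _ : Fin n => μ.prod μ) := by
          refine (lintegral_finsetSum _ fun σ _ => hGm.comp ?_).symm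
          exact (measurePreserving_pi (fun _ : Fin n => μ.prod μ) (fun _ => μ.prod μ)
            (fun j => measurePreserving_swapIf μ (σ j))).measurable
      _ ≤ ∫⁻ _, ENNReal.ofReal (2 ^ n * (2 * Real.exp (2 * s ^ 2 * n))) ∂(Measure.pi fun _ : Fin n => μ.prod μ) :=
          lintegral_mono h3
      _ = _ := by
          rw [lintegral_const, measure_univ, mul_one, ENNReal.ofReal_mul (by positivity),
            ENNReal.ofReal_pow (by norm_num), ENNReal.ofReal_ofNat]
  exact (ENNReal.mul_le_mul_iff_right (by simp) (by simp)).1 h4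

/-- One-sided uniform deviation inequality for sign-bounded families, by symmetrization. -/
lemma measure_deviation_le [Countable ι] {v : ι → Y → ℝ} (hm : ∀ i, Measurable (v i)) (hb : ∀ i y, |v i y| ≤ 1)
    (hv : SignBounded v) (n : ℕ) {η : ℝ} (hη : 0 ≤ η) :
    (Measure.pi fun _ : Fin n => μ) {y | ∃ i, n * η ≤ ∑ j, v i (y j) - n * ∫ y, v i y ∂μ} ≤
      ENNReal.ofReal (2 * Real.exp (-(n * η ^ 2 / 8))) := by
  -- Minimizes the Chernoff exponent `2 s² n - s n η`, with value `-n η² / 8`.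
  set s := η / 4 with hs
  set F : (Fin n → Y) × (Fin n → Y) → ENNReal := fun p =>
    ⨆ i, ENNReal.ofReal (Real.exp (s * (∑ j, v i (p.1 j) - ∑ j, v i (p.2 j)))) with hF
  have hFm : Measurable F := by
    refine Measurable.iSup fun i => ?_
    have := hm i
    fun_prop
  set c := ENNReal.ofReal (Real.exp (s * (n * η))) with hc
  have hsub : {y : Fin n → Y | ∃ i, n * η ≤ ∑ j, v i (y j) - n * ∫ y, v i y ∂μ} ⊆
      {y | c ≤ ∫⁻ y', F (y, y') ∂Measure.pi fun _ => μ} := by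
    rintro y ⟨i, hi⟩
    calc c ≤ ENNReal.ofReal (Real.exp (s * (∑ j, v i (y j) - n * ∫ y, v i y ∂μ))) := by
          refine ENNReal.ofReal_le_ofReal (Real.exp_le_exp.2 ?_)
          exact mul_le_mul_of_nonneg_left hi (by positivity)
      _ ≤ _ := exp_sub_mean_le_lintegral μ (hm i) (hb i) n s _
      _ ≤ _ := lintegral_mono fun y' =>
          le_iSup (fun i => ENNReal.ofReal (Real.exp (s * (∑ j, v i (y j) - ∑ j, v i (y' j))))) i
  have h1 : c * (Measure.pi fun _ : Fin n => μ) {y | c ≤ ∫⁻ y', F (y, y') ∂Measure.pi fun _ => μ} ≤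
      ENNReal.ofReal (2 * Real.exp (2 * s ^ 2 * n)) := by
    refine (mul_meas_ge_le_lintegral hFm.lintegral_prod_right' c).trans ?_
    rw [← lintegral_prod _ hFm.aemeasurable]
    exact lintegral_symmetrized_le μ hm hv n (by positivity)
  have h2 : ENNReal.ofReal (2 * Real.exp (2 * s ^ 2 * n)) = c * ENNReal.ofReal (2 * Real.exp (-(n * η ^ 2 / 8))) := by
    rw [hc, ← ENNReal.ofReal_mul (Real.exp_pos _).le]
    congr 1
    rw [mul_left_comm, ← Real.exp_add]
    congr 2
    rw [hs]; ring
  rw [h2] at h1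
  exact (measure_mono hsub).trans
    ((ENNReal.mul_le_mul_iff_right (by simp [hc, Real.exp_pos]) (by simp [hc])).1 h1)

/-- Uniform deviation inequality for a family of monotone functions of a random variable. -/
lemma measure_monotone_deviation_le [Countable ι] {X : Y → ℝ} (hX : Measurable X) {u : ι → ℝ → ℝ}
    (hu : ∀ i, Monotone (u i)) (h0 : ∀ i x, 0 ≤ u i x) (h1 : ∀ i x, u i x ≤ 1) (n : ℕ) {η : ℝ} (hη : 0 ≤ η) :
    (Measure.pi fun _ : Fin n => μ) {y | ∃ i, n * η < |∑ j, u i (X (y j)) - n * ∫ y, u i (X y) ∂μ|} ≤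
      ENNReal.ofReal (4 * Real.exp (-(n * η ^ 2 / 8))) := by
  have hv := signBounded_of_monotone X u hu h0 h1
  have hm : ∀ i, Measurable fun y => u i (X y) := fun i => (hu i).measurable.comp hX
  have hb : ∀ i y, |u i (X y)| ≤ 1 := fun i y => by rw [abs_of_nonneg (h0 _ _)]; exact h1 _ _
  have hP := measure_deviation_le μ hm hb hv n hη
  have hN := measure_deviation_le μ (v := fun i y => -u i (X y)) (fun i => (hm i).neg)
    (fun i y => by rw [abs_neg]; exact hb i y) hv.neg n hη
  refine (measure_mono ?_).trans ((measure_union_le _ _).trans ((add_le_add hP hN).trans (le_of_eq ?_)))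
  · rintro y ⟨i, hi⟩
    rcases lt_abs.1 hi with h | h
    · exact Or.inl ⟨i, h.le⟩
    · refine Or.inr ⟨i, ?_⟩
      rw [integral_neg, Finset.sum_neg_distrib]
      linarith
  · rw [← ENNReal.ofReal_add (by positivity) (by positivity)]
    congr 1; ring

end Concentration

/-! ### Monotone submodular functions and curvature -/

section Submodular

variable {E : Type*} [DecidableEq E]

lemma IsMonoSubmodular.of_notMem {h : Finset E → ℝ} (hm : ∀ A B, A ⊆ B → h A ≤ h B)
    (hs : ∀ A B, A ⊆ B → ∀ e, e ∉ B → h (insert e B) - h B ≤ h (insert e A) - h A) : IsMonoSubmodular h where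
  mono := hm
  submod A B hAB e := by
    by_cases he : e ∈ B
    · rw [Finset.insert_eq_of_mem he, sub_self]
      exact sub_nonneg.2 (hm _ _ (Finset.subset_insert _ _))
    · exact hs A B hAB e he

lemma IsMonoSubmodular.add {h₁ h₂ : Finset E → ℝ} (h : IsMonoSubmodular h₁) (h' : IsMonoSubmodular h₂) :
    IsMonoSubmodular (fun S => h₁ S + h₂ S) where
  mono A B hAB := add_le_add (h.mono A B hAB) (h'.mono A B hAB)
  submod A B hAB e := by linarith [h.submod A B hAB e, h'.submod A B hAB e]

lemma IsMonoSubmodular.const_mul {h : Finset E → ℝ} (hh : IsMonoSubmodular h) {c : ℝ} (hc : 0 ≤ c) :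
    IsMonoSubmodular (fun S => c * h S) where
  mono A B hAB := mul_le_mul_of_nonneg_left (hh.mono A B hAB) hc
  submod A B hAB e := by
    have := mul_le_mul_of_nonneg_left (hh.submod A B hAB e) hc
    linarith

lemma isMonoSubmodular_const (c : ℝ) : IsMonoSubmodular (fun _ : Finset E => c) where
  mono _ _ _ := le_rfl
  submod _ _ _ _ := le_rfl

lemma isMonoSubmodular_finset_sum {J : Type*} (s : Finset J) {h : J → Finset E → ℝ}
    (hh : ∀ j, IsMonoSubmodular (h j)) : IsMonoSubmodular (fun S => ∑ j ∈ s, h j S) where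
  mono A B hAB := Finset.sum_le_sum fun j _ => (hh j).mono A B hAB
  submod A B hAB e := by
    rw [← Finset.sum_sub_distrib, ← Finset.sum_sub_distrib]
    exact Finset.sum_le_sum fun j _ => (hh j).submod A B hAB e

lemma isMonoSubmodular_integral {Y : Type*} [MeasurableSpace Y] {μ : Measure Y} {h : Finset E → Y → ℝ}
    (hi : ∀ S, Integrable (h S) μ) (hh : ∀ y, IsMonoSubmodular (fun S => h S y)) :
    IsMonoSubmodular (fun S => ∫ y, h S y ∂μ) where
  mono A B hAB := integral_mono (hi A) (hi B) fun y => (hh y).mono A B hAB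
  submod A B hAB e := by
    rw [← integral_sub (hi _) (hi _), ← integral_sub (hi _) (hi _)]
    exact integral_mono ((hi _).sub (hi _)) ((hi _).sub (hi _)) fun y => (hh y).submod A B hAB e

lemma isMonoSubmodular_sum {w : E → ℝ} (hw : ∀ e, 0 ≤ w e) : IsMonoSubmodular (fun S => ∑ e ∈ S, w e) :=
  .of_notMem (fun _ _ hAB => Finset.sum_le_sum_of_subset_of_nonneg hAB fun e _ _ => hw e) fun A B hAB e he => by
    rw [Finset.sum_insert he, Finset.sum_insert fun h => he (hAB h)]
    linarith

lemma isMonoSubmodular_coverage {P : Type*} [DecidableEq P] (obs : E → Finset P) {w : P → ℝ} (hw : ∀ p, 0 ≤ w p) :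
    IsMonoSubmodular (fun S => ∑ p ∈ S.biUnion obs, w p) where
  mono A B hAB := Finset.sum_le_sum_of_subset_of_nonneg (Finset.biUnion_subset_biUnion_of_subset_left _ hAB)
    fun p _ _ => hw p
  submod A B hAB e := by
    have h : ∀ S : Finset E, ∑ p ∈ (insert e S).biUnion obs, w p - ∑ p ∈ S.biUnion obs, w p =
        ∑ p ∈ obs e \ S.biUnion obs, w p := by
      intro S
      rw [Finset.biUnion_insert, ← Finset.sdiff_union_self_eq_union, Finset.sum_union Finset.sdiff_disjoint]
      ring
    simp only [h]
    exact Finset.sum_le_sum_of_subset_of_nonneg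
      (Finset.sdiff_subset_sdiff subset_rfl (Finset.biUnion_subset_biUnion_of_subset_left _ hAB)) fun p _ _ => hw p

/-- Truncation preserves monotone submodularity. -/
lemma IsMonoSubmodular.neg_shortfall {h : Finset E → ℝ} (hh : IsMonoSubmodular h) (τ : ℝ) :
    IsMonoSubmodular (fun S => -max (τ - h S) 0) where
  mono A B hAB := by
    have := hh.mono A B hAB
    exact neg_le_neg (max_le_max (by linarith) le_rfl)
  submod A B hAB e := by
    have h1 := hh.mono A B hAB
    have h2 := hh.submod A B hAB e
    have h3 := hh.mono _ _ (Finset.subset_insert e A)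
    have h4 := hh.mono _ _ (Finset.subset_insert e B)
    rcases max_cases (τ - h (insert e B)) 0 with ⟨a1, b1⟩ | ⟨a1, b1⟩ <;>
    rcases max_cases (τ - h B) 0 with ⟨a2, b2⟩ | ⟨a2, b2⟩ <;>
    rcases max_cases (τ - h (insert e A)) 0 with ⟨a3, b3⟩ | ⟨a3, b3⟩ <;>
    rcases max_cases (τ - h A) 0 with ⟨a4, b4⟩ | ⟨a4, b4⟩ <;>
    linarith

section Curvature

variable {family : Set (Finset E)} {h : Finset E → ℝ}

lemma curvature_ratios_nonneg (hh : IsMonoSubmodular h) {ρ : ℝ}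
    (hρ : ∃ S ∈ family, ∃ s ∈ S, h {s} - h ∅ ≠ 0 ∧
      ρ = (h S - h ∅ - (h (S.erase s) - h ∅)) / (h {s} - h ∅)) : 0 ≤ ρ := by
  obtain ⟨S, _, s, _, _, rfl⟩ := hρ
  have h1 := hh.mono _ _ (Finset.erase_subset s S)
  have h2 := hh.mono _ _ (Finset.empty_subset {s})
  exact div_nonneg (by linarith) (by linarith)

lemma curvature_le_one (hh : IsMonoSubmodular h) : curvature family (fun S => h S - h ∅) ≤ 1 :=
  sub_le_self _ (Real.sInf_nonneg fun _ hρ => curvature_ratios_nonneg hh hρ)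

lemma curvature_nonneg (hh : IsMonoSubmodular h) : 0 ≤ curvature family (fun S => h S - h ∅) := by
  refine sub_nonneg.2 ?_
  rcases Set.eq_empty_or_nonempty {ρ | ∃ S ∈ family, ∃ s ∈ S, h {s} - h ∅ ≠ 0 ∧
      ρ = (h S - h ∅ - (h (S.erase s) - h ∅)) / (h {s} - h ∅)} with hE | ⟨ρ, hρ⟩
  -- Without admissible ratios the infimum is 0, so the curvature is 1, as the convention demands.
  · rw [hE, Real.sInf_empty]; exact zero_le_one
  · refine (csInf_le ⟨0, fun _ hρ => curvature_ratios_nonneg hh hρ⟩ hρ).trans ?_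
    obtain ⟨S, _, s, hs, _, rfl⟩ := hρ
    have h1 := hh.submod ∅ (S.erase s) (Finset.empty_subset _) s
    rw [Finset.insert_erase hs] at h1
    have h2 := hh.mono _ _ (Finset.empty_subset {s})
    refine div_le_one_of_le₀ ?_ (by linarith)
    have h3 : h (insert s ∅) = h {s} := rfl
    linarith

lemma one_sub_curvature_mul_le (hh : IsMonoSubmodular h) {S : Finset E} (hS : S ∈ family) {s : E} (hs : s ∈ S) :
    (1 - curvature family (fun S => h S - h ∅)) * (h {s} - h ∅) ≤ h S - h (S.erase s) := by
  have h1 := hh.mono _ _ (Finset.erase_subset s S)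
  have h2 := hh.mono _ _ (Finset.empty_subset {s})
  by_cases h0 : h {s} - h ∅ = 0
  · rw [h0]; linarith
  · have hpos : 0 < h {s} - h ∅ := lt_of_le_of_ne (by linarith) (Ne.symm h0)
    rw [curvature, sub_sub_cancel, ← le_div_iff₀ hpos]
    exact csInf_le ⟨0, fun _ hρ => curvature_ratios_nonneg hh hρ⟩ ⟨S, hS, s, hs, h0, by ring⟩

end Curvature

end Submodular

/-! ### The auxiliary function and its sampled version -/

section Objective

variable {V P Yr Yc : Type*} [Fintype V] [DecidableEq V] [DecidableEq P]
  [MeasurableSpace Yr] [MeasurableSpace Yc] (Q : Problem V P Yr Yc)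

omit [Fintype V] [DecidableEq V] in
lemma Problem.utility_eq (S : Finset (Sym2 V)) (y : Yr × Yc) :
    Q.utility S y = (1 - Q.β) * ∑ p ∈ S.biUnion Q.observed, Q.reward p y.1 +
      Q.β * ∑ e ∈ S, (Q.costBound - Q.cost e y.2) := by
  simp [Problem.utility, Problem.totalReward, Problem.totalCost]

omit [Fintype V] in
lemma Problem.isMonoSubmodular_utility (y : Yr × Yc) : IsMonoSubmodular (fun S => Q.utility S y) := by
  simp only [Q.utility_eq]
  exact ((isMonoSubmodular_coverage Q.observed fun p => Q.reward_nonneg p y.1).const_mul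
    (sub_nonneg.2 Q.β_le_one)).add
    ((isMonoSubmodular_sum fun e => sub_nonneg.2 (Q.cost_le e y.2)).const_mul Q.β_nonneg)

omit [Fintype V] [DecidableEq V] in
lemma Problem.utility_empty (y : Yr × Yc) : Q.utility ∅ y = 0 := by
  simp [Q.utility_eq]

omit [Fintype V] in
lemma Problem.utility_nonneg (S : Finset (Sym2 V)) (y : Yr × Yc) : 0 ≤ Q.utility S y := by
  rw [← Q.utility_empty y]
  exact (Q.isMonoSubmodular_utility y).mono _ _ (Finset.empty_subset S)

omit [Fintype V] [DecidableEq V] in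
lemma Problem.measurable_utility (S : Finset (Sym2 V)) : Measurable (Q.utility S) := by
  have h : Q.utility S = fun y => (1 - Q.β) * ∑ p ∈ S.biUnion Q.observed, Q.reward p y.1 +
      Q.β * ∑ e ∈ S, (Q.costBound - Q.cost e y.2) := funext fun y => Q.utility_eq S y
  rw [h]
  have h1 := fun p => Q.measurable_reward p
  have h2 := fun e => Q.measurable_cost e
  fun_prop

omit [Fintype V] in
lemma Problem.shortfall_le {τ : ℝ} (hτ : 0 ≤ τ) (S : Finset (Sym2 V)) (y : Yr × Yc) :
    max (τ - Q.utility S y) 0 ≤ τ :=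
  max_le (by linarith [Q.utility_nonneg S y]) hτ

omit [Fintype V] in
lemma Problem.integrable_shortfall {τ : ℝ} (hτ : 0 ≤ τ) (S : Finset (Sym2 V)) :
    Integrable (fun y => max (τ - Q.utility S y) 0) Q.law := by
  have := Q.isProbabilityMeasure_law
  refine Integrable.of_bound (((measurable_const.sub (Q.measurable_utility S)).max
    measurable_const).aestronglyMeasurable) τ (Filter.Eventually.of_forall fun y => ?_)
  rw [Real.norm_eq_abs, abs_of_nonneg (le_max_right _ _)]
  exact Q.shortfall_le hτ S y

omit [Fintype V] in
lemma Problem.isMonoSubmodular_H {α τ : ℝ} (hα : 0 < α) (hτ : 0 ≤ τ) : IsMonoSubmodular (fun S => Q.H α S τ) := by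
  have h1 := isMonoSubmodular_integral (μ := Q.law) (h := fun S y => -max (τ - Q.utility S y) 0)
    (fun S => (Q.integrable_shortfall hτ S).neg) fun y => (Q.isMonoSubmodular_utility y).neg_shortfall τ
  have h2 := (isMonoSubmodular_const τ).add (h1.const_mul (one_div_pos.2 hα).le)
  simp only [integral_neg] at h2
  convert h2 using 2
  rw [Problem.H]; ring

omit [Fintype V] in
lemma Problem.isMonoSubmodular_sampledH {α : ℝ} (hα : 0 < α) {ns : ℕ} (ys : Fin ns → Yr × Yc) (τ : ℝ) :
    IsMonoSubmodular (fun S => Q.sampledH α ys S τ) := by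
  have h1 := isMonoSubmodular_finset_sum Finset.univ (h := fun j S => -max (τ - Q.utility S (ys j)) 0)
    fun j => (Q.isMonoSubmodular_utility (ys j)).neg_shortfall τ
  have h2 := (isMonoSubmodular_const τ).add ((h1.const_mul (by positivity : 0 ≤ 1 / (ns : ℝ))).const_mul
    (one_div_pos.2 hα).le)
  simp only [Finset.sum_neg_distrib] at h2
  convert h2 using 2
  rw [Problem.sampledH]; ring

omit [Fintype V] in
lemma Problem.sampledH_zero (α : ℝ) {ns : ℕ} (ys : Fin ns → Yr × Yc) (S : Finset (Sym2 V)) :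
    Q.sampledH α ys S 0 = 0 := by
  have h : ∀ j, max (0 - Q.utility S (ys j)) 0 = 0 := fun j =>
    max_eq_right (by linarith [Q.utility_nonneg S (ys j)])
  simp only [Problem.sampledH, h]
  simp

omit [Fintype V] in
lemma Problem.H_zero (α : ℝ) (S : Finset (Sym2 V)) : Q.H α S 0 = 0 := by
  have h : ∀ y, max (0 - Q.utility S y) 0 = 0 := fun y => max_eq_right (by linarith [Q.utility_nonneg S y])
  simp only [Problem.H, h]
  simp

omit [Fintype V] [DecidableEq V] in
lemma Problem.sampledH_empty (α : ℝ) {ns : ℕ} (hns : 0 < ns) (ys : Fin ns → Yr × Yc) {τ : ℝ} (hτ : 0 ≤ τ) :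
    Q.sampledH α ys ∅ τ = τ * (1 - 1 / α) := by
  have hns' : (ns : ℝ) ≠ 0 := by positivity
  simp only [Problem.sampledH, Q.utility_empty, sub_zero, max_eq_left hτ, Finset.sum_const, Finset.card_univ,
    Fintype.card_fin, nsmul_eq_mul]
  field_simp

omit [Fintype V] in
lemma Problem.H_le_add {α : ℝ} (hα : 0 < α) (S : Finset (Sym2 V)) {τ τ' : ℝ} (h0 : 0 ≤ τ') (h : τ' ≤ τ) :
    Q.H α S τ ≤ Q.H α S τ' + (τ - τ') := by
  have h1 : ∫ y, max (τ' - Q.utility S y) 0 ∂Q.law ≤ ∫ y, max (τ - Q.utility S y) 0 ∂Q.law :=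
    integral_mono (Q.integrable_shortfall h0 S) (Q.integrable_shortfall (h0.trans h) S) fun y =>
      max_le_max (by linarith) le_rfl
  have h2 := mul_le_mul_of_nonneg_left h1 (one_div_pos.2 hα).le
  rw [Problem.H, Problem.H]
  linarith

omit [Fintype V] in
/-- `H(S, τ) / τ` is nonincreasing in `τ`. -/
lemma Problem.mul_H_le_mul_H {α : ℝ} (hα : 0 < α) (S : Finset (Sym2 V)) {τ τ' : ℝ} (h0 : 0 ≤ τ') (h : τ' ≤ τ) :
    τ' * Q.H α S τ ≤ τ * Q.H α S τ' := by
  have h1 : ∫ y, τ * max (τ' - Q.utility S y) 0 ∂Q.law ≤ ∫ y, τ' * max (τ - Q.utility S y) 0 ∂Q.law := by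
    refine integral_mono ((Q.integrable_shortfall h0 S).const_mul _)
      ((Q.integrable_shortfall (h0.trans h) S).const_mul _) fun y => ?_
    show τ * max (τ' - Q.utility S y) 0 ≤ τ' * max (τ - Q.utility S y) 0
    rw [mul_max_of_nonneg _ _ (h0.trans h), mul_max_of_nonneg _ _ h0, mul_zero, mul_zero]
    refine max_le_max ?_ le_rfl
    nlinarith [Q.utility_nonneg S y]
  rw [integral_const_mul, integral_const_mul] at h1
  have h2 := mul_le_mul_of_nonneg_left h1 (one_div_pos.2 hα).le
  rw [Problem.H, Problem.H]
  linarith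

/-- The truncation of `x` to `[0, τ]`, divided by `τ`. -/
noncomputable def truncRatio (τ x : ℝ) : ℝ := max 0 (min x τ) / τ

lemma truncRatio_monotone {τ : ℝ} (hτ : 0 ≤ τ) : Monotone (truncRatio τ) := fun _ _ h =>
  div_le_div_of_nonneg_right (max_le_max le_rfl (min_le_min h le_rfl)) hτ

lemma truncRatio_nonneg {τ : ℝ} (hτ : 0 ≤ τ) (x : ℝ) : 0 ≤ truncRatio τ x :=
  div_nonneg (le_max_left _ _) hτ

lemma truncRatio_le_one {τ : ℝ} (hτ : 0 ≤ τ) (x : ℝ) : truncRatio τ x ≤ 1 :=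
  div_le_one_of_le₀ (max_le hτ (min_le_right _ _)) hτ

lemma max_sub_eq_truncRatio {τ x : ℝ} (hτ : 0 < τ) (hx : 0 ≤ x) : max (τ - x) 0 = τ - τ * truncRatio τ x := by
  rw [truncRatio, mul_div_cancel₀ _ hτ.ne', max_eq_right (le_min hx hτ.le)]
  rcases le_total x τ with h | h
  · rw [min_eq_left h, max_eq_left (by linarith)]
  · rw [min_eq_right h, max_eq_right (by linarith), sub_self]

-- The error is proportional to `τ`; the early exit argument relies on this.
omit [Fintype V] in
lemma Problem.abs_sampledH_sub_le {α η τ : ℝ} (hα : 0 < α) {ns : ℕ} (hns : 0 < ns) (hτ : 0 ≤ τ)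
    (ys : Fin ns → Yr × Yc) (S : Finset (Sym2 V))
    (hdev : |∑ j, truncRatio τ (Q.utility S (ys j)) - ns * ∫ y, truncRatio τ (Q.utility S y) ∂Q.law| ≤ ns * η) :
    |Q.sampledH α ys S τ - Q.H α S τ| ≤ τ * η / α := by
  rcases hτ.eq_or_lt with rfl | hτ
  · simp [Q.sampledH_zero, Q.H_zero]
  have := Q.isProbabilityMeasure_law
  have hns' : (0 : ℝ) < ns := by exact_mod_cast hns
  have hint : Integrable (fun y => truncRatio τ (Q.utility S y)) Q.law :=
    Integrable.of_bound ((truncRatio_monotone hτ.le).measurable.comp (Q.measurable_utility S)).aestronglyMeasurable 1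
      (Filter.Eventually.of_forall fun y => by
        rw [Real.norm_eq_abs, abs_of_nonneg (truncRatio_nonneg hτ.le _)]
        exact truncRatio_le_one hτ.le _)
  have h1 : Q.H α S τ = τ - 1 / α * (τ - τ * ∫ y, truncRatio τ (Q.utility S y) ∂Q.law) := by
    rw [Problem.H]
    simp_rw [fun y => max_sub_eq_truncRatio hτ (Q.utility_nonneg S y)]
    rw [integral_sub (integrable_const _) (hint.const_mul _), integral_const_mul]
    simp
  have h2 : Q.sampledH α ys S τ = τ - 1 / α * (τ - τ * (1 / ns * ∑ j, truncRatio τ (Q.utility S (ys j)))) := by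
    rw [Problem.sampledH]
    simp_rw [fun y => max_sub_eq_truncRatio hτ (Q.utility_nonneg S y)]
    rw [Finset.sum_sub_distrib, ← Finset.mul_sum, Finset.sum_const, Finset.card_univ, Fintype.card_fin, nsmul_eq_mul]
    field_simp
  have h3 : Q.sampledH α ys S τ - Q.H α S τ = τ / (α * ns) *
      (∑ j, truncRatio τ (Q.utility S (ys j)) - ns * ∫ y, truncRatio τ (Q.utility S y) ∂Q.law) := by
    rw [h1, h2]; field_simp; ring
  rw [h3, abs_mul, abs_of_pos (by positivity)]
  refine (mul_le_mul_of_nonneg_left hdev (by positivity)).trans (le_of_eq ?_)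
  field_simp

variable {α Γ γ : ℝ}

lemma Problem.curvatureH_spec (hα : 0 < α) (hγ : 0 < γ) (hγΓ : γ ≤ Γ) :
    0 ≤ Q.curvatureH α Γ γ ∧ Q.curvatureH α Γ γ ≤ 1 ∧
      ∀ i : ℕ, 0 < i → (i : ℝ) * γ ≤ Γ → ∀ A ∈ feasible V, ∀ e ∈ A,
        (1 - Q.curvatureH α Γ γ) * (Q.H α {e} (i * γ) - Q.H α ∅ (i * γ)) ≤
          Q.H α A (i * γ) - Q.H α (A.erase e) (i * γ) := by
  have hsub : ∀ i : ℕ, IsMonoSubmodular fun S => Q.H α S (i * γ) := fun i => Q.isMonoSubmodular_H hα (by positivity)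
  have hub : ∀ x ∈ {κ | ∃ i : ℕ, 0 < i ∧ (i : ℝ) * γ ≤ Γ ∧
      κ = curvature (feasible V) (fun S => Q.H α S (i * γ) - Q.H α ∅ (i * γ))}, x ≤ 1 := by
    rintro _ ⟨i, _, _, rfl⟩
    exact curvature_le_one (hsub i)
  have hmem : ∀ i : ℕ, 0 < i → (i : ℝ) * γ ≤ Γ →
      curvature (feasible V) (fun S => Q.H α S (i * γ) - Q.H α ∅ (i * γ)) ≤ Q.curvatureH α Γ γ := fun i h1 h2 =>
    le_csSup ⟨1, hub⟩ ⟨i, h1, h2, rfl⟩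
  refine ⟨?_, ?_, fun i h1 h2 A hA e he => ?_⟩
  · exact (curvature_nonneg (hsub 1)).trans (hmem 1 one_pos (by simpa using hγΓ))
  · exact csSup_le ⟨_, 1, one_pos, by simpa using hγΓ, rfl⟩ hub
  · refine le_trans ?_ (one_sub_curvature_mul_le (hsub i) hA he)
    refine mul_le_mul_of_nonneg_right (by linarith [hmem i h1 h2]) ?_
    exact sub_nonneg.2 ((hsub i).mono _ _ (Finset.empty_subset {e}))

end Objective

/-! ### The outer loop -/

section Search

variable {V : Type*} [Fintype V] [DecidableEq V]

lemma exists_searchRun (Hhat : Finset (Sym2 V) → ℝ → ℝ) (γ : ℝ) (N i : ℕ) (m : ℝ) (b : Finset (Sym2 V) × ℝ) :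
    ∃ b', SearchRun Hhat γ N i m b b' := by
  induction hk : N + 1 - i generalizing i m b with
  | zero => exact ⟨b, .finish (by omega)⟩
  | succ k ih =>
    obtain ⟨S, c, hrun⟩ := exists_greedyRun (fun T => Hhat T (i * γ)) (R := allEdges V) (S := ∅) 0 (by simp)
    by_cases hc : c < 0
    · exact ⟨_, .exit (by omega) hrun hc⟩
    · obtain ⟨b', hb'⟩ := ih (i + 1) (if m ≤ c then c else m) (if m ≤ c then (S, i * γ) else b) (by omega)
      exact ⟨b', .next (by omega) hrun hc hb'⟩

/-- The pair `b` is a tour with a search value of index at most `N`, and its value is `m ≥ 0`. -/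
structure IsCandidate (Hhat : Finset (Sym2 V) → ℝ → ℝ) (γ : ℝ) (N : ℕ) (m : ℝ) (b : Finset (Sym2 V) × ℝ) : Prop where
  isTour : IsTour b.1
  exists_index : ∃ j : ℕ, j ≤ N ∧ b.2 = j * γ
  value : Hhat b.1 b.2 = m
  nonneg : 0 ≤ m

/-- For each index, either its run was compared with the best value or the loop had already stopped
at a negative one. The starting pair is no tour, but the value at `τ = 0` is 0, so the first
iteration always replaces it and never exits. -/
lemma SearchRun.spec (hn : 3 ≤ Fintype.card V) {Hhat : Finset (Sym2 V) → ℝ → ℝ} (h0 : ∀ S, Hhat S 0 = 0) {γ : ℝ}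
    {N i : ℕ} {m : ℝ} {b b' : Finset (Sym2 V) × ℝ} (hrun : SearchRun Hhat γ N i m b b')
    (hb : (i = 0 ∧ m = 0) ∨ IsCandidate Hhat γ N m b) :
    ∃ m', IsCandidate Hhat γ N m' b' ∧ m ≤ m' ∧ ∀ l, i ≤ l → l ≤ N →
      (∃ S c, GreedyRun (fun T => Hhat T (l * γ)) (allEdges V) ∅ 0 S c ∧ c ≤ m') ∨
      ∃ j, j ≤ l ∧ ∃ S c, GreedyRun (fun T => Hhat T (j * γ)) (allEdges V) ∅ 0 S c ∧ c < 0 := by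
  induction hrun with
  | finish hi =>
    rcases hb with ⟨rfl, _⟩ | hb
    · omega
    · exact ⟨_, hb, le_rfl, fun l h1 h2 => by omega⟩
  | @exit i m c b S hi hrun hc =>
    have hval := (hrun.isTour_and_value hn).2
    rcases hb with ⟨rfl, _⟩ | hb
    · simp [h0] at hval
      linarith
    · rw [if_neg (by linarith [hb.nonneg])]
      exact ⟨m, hb, le_rfl, fun l h1 _ => Or.inr ⟨i, h1, S, c, hrun, hc⟩⟩
  | @next i m c b b' S hi hrun hc hrest ih =>
    obtain ⟨htour, hval⟩ := hrun.isTour_and_value hn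
    have hcand : IsCandidate Hhat γ N (if m ≤ c then c else m) (if m ≤ c then (S, i * γ) else b) := by
      split_ifs with hmc
      · exact ⟨htour, ⟨i, hi, rfl⟩, hval.symm, not_lt.1 hc⟩
      · rcases hb with ⟨_, rfl⟩ | hb
        · exact absurd (not_lt.1 hc) hmc
        · exact hb
    obtain ⟨m', h1, h2, h3⟩ := ih (Or.inr hcand)
    have hmc : c ≤ m' ∧ m ≤ m' := by
      split_ifs at h2 with h
      · exact ⟨h2, h.trans h2⟩
      · exact ⟨(not_le.1 h).le.trans h2, h2⟩
    refine ⟨m', h1, hmc.2, fun l h4 h5 => ?_⟩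
    rcases h4.eq_or_lt with rfl | h4
    · exact Or.inl ⟨S, c, hrun, hmc.1⟩
    · exact h3 l h4 h5

lemma RAGAReturns.isTour (hn : 3 ≤ Fintype.card V) {Hhat : Finset (Sym2 V) → ℝ → ℝ} (h0 : ∀ S, Hhat S 0 = 0)
    {Γ γ : ℝ} {S : Finset (Sym2 V)} {τ : ℝ} (h : RAGAReturns Hhat Γ γ S τ) : IsTour S := by
  obtain ⟨_, hc, _⟩ := SearchRun.spec hn h0 h (Or.inl ⟨rfl, rfl⟩)
  exact hc.isTour

end Search

/-! ### The approximation guarantee -/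

section Guarantee

variable {V P Yr Yc : Type*} [Fintype V] [DecidableEq V] [DecidableEq P]
  [MeasurableSpace Yr] [MeasurableSpace Yc] (Q : Problem V P Yr Yc) {α Γ γ η : ℝ} {ns : ℕ} {ys : Fin ns → Yr × Yc}

/-- The guarantee of one greedy run on the sampled function, at a positive search value of `[0, Γ]`. -/
lemma Problem.greedy_guarantee (hn : 3 ≤ Fintype.card V) (hα : 0 < α) (hγ : 0 < γ) (hγΓ : γ ≤ Γ) (hns : 0 < ns)
    {i : ℕ} (hi : 0 < i) (hiΓ : (i : ℝ) * γ ≤ Γ)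
    (hdev : ∀ S, |Q.sampledH α ys S (i * γ) - Q.H α S (i * γ)| ≤ (i * γ) * η / α)
    {O : Finset (Sym2 V)} (hO : O ∈ feasible V) {S : Finset (Sym2 V)} {c : ℝ}
    (hrun : GreedyRun (fun T => Q.sampledH α ys T (i * γ)) (allEdges V) ∅ 0 S c) :
    Q.H α O (i * γ) + (1 + Q.curvatureH α Γ γ) * ((i * γ) * (1 - 1 / α))
      - (4 * Fintype.card V + 1) * ((i * γ) * η / α) ≤ (2 + Q.curvatureH α Γ γ) * c := by
  obtain ⟨hk0, hk1, hk⟩ := Q.curvatureH_spec (V := V) (Γ := Γ) hα hγ hγΓ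
  set k := Q.curvatureH α Γ γ
  set τ := (i : ℝ) * γ
  set d := τ * η / α
  have hτ : 0 ≤ τ := by positivity
  have hd : 0 ≤ d := (abs_nonneg _).trans (hdev ∅)
  -- Four evaluations are exchanged between `H` and its sampled version, each off by at most `d`.
  -- Over `n` edges this gives `4 n d`; comparing the values at `O` adds one more `d`.
  have hcurv : ∀ A, IsPartialTour A → ∀ e ∈ A, (1 - k) * (Q.sampledH α ys {e} τ - Q.sampledH α ys ∅ τ) - 4 * d ≤
      Q.sampledH α ys A τ - Q.sampledH α ys (A.erase e) τ := by
    intro A hA e he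
    have h1 := hk i hi hiΓ A (hA.mem_feasible hn) e he
    have h2 := abs_le.1 (hdev {e})
    have h3 := abs_le.1 (hdev ∅)
    have h4 := abs_le.1 (hdev A)
    have h5 := abs_le.1 (hdev (A.erase e))
    have h6 : (1 - k) * (Q.sampledH α ys {e} τ - Q.sampledH α ys ∅ τ) ≤
        (1 - k) * (Q.H α {e} τ - Q.H α ∅ τ + 2 * d) :=
      mul_le_mul_of_nonneg_left (by linarith) (by linarith)
    have h7 : (1 - k) * (2 * d) ≤ 1 * (2 * d) := mul_le_mul_of_nonneg_right (by linarith) (by linarith)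
    linarith
  have h1 := hrun.tour_le hn (Q.isMonoSubmodular_sampledH hα ys τ) hk1 hcurv hO
  rw [Q.sampledH_empty α hns ys hτ] at h1
  rw [(hrun.isTour_and_value hn).2]
  have h2 := abs_le.1 (hdev O)
  linarith

lemma Problem.raga_guarantee (hn : 3 ≤ Fintype.card V) (hα : 0 < α) (hα₁ : α ≤ 1) (hγ : 0 < γ) (hγΓ : γ ≤ Γ)
    (hη : 0 ≤ η) (hns : 0 < ns)
    (hdev : ∀ S, ∀ i : ℕ, |Q.sampledH α ys S (i * γ) - Q.H α S (i * γ)| ≤ (i * γ) * η / α)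
    {S : Finset (Sym2 V)} {τ : ℝ} (hrun : RAGAReturns (Q.sampledH α ys) Γ γ S τ)
    {O : Finset (Sym2 V)} {τO : ℝ} (hO : Q.IsOptimal α Γ O τO) :
    1 / (2 + Q.curvatureH α Γ γ) * (Q.H α O τO - γ)
      + (1 + Q.curvatureH α Γ γ) / (2 + Q.curvatureH α Γ γ) * (Γ * (1 - 1 / α))
      - 6 * Fintype.card V * (Γ * η / α) ≤ Q.H α S τ := by
  obtain ⟨m, hcand, -, hsearch⟩ := SearchRun.spec hn (Q.sampledH_zero α ys) hrun (Or.inl ⟨rfl, rfl⟩)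
  obtain ⟨hk0, -, -⟩ := Q.curvatureH_spec (V := V) (Γ := Γ) hα hγ hγΓ
  obtain ⟨hOf, ⟨hτO0, hτOΓ⟩, -⟩ := hO
  set k := Q.curvatureH α Γ γ
  set nV : ℝ := (Fintype.card V : ℝ) with hnV
  have hnV3 : (3 : ℝ) ≤ nV := by rw [hnV]; exact_mod_cast hn
  have hΓ : 0 < Γ := hγ.trans_le hγΓ
  set D := Γ * η / α with hD
  have hD0 : 0 ≤ D := by positivity
  have hα1 : 1 - 1 / α ≤ 0 := by rw [sub_nonpos, le_div_iff₀ hα]; linarith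
  have hscale : ∀ x, x ≤ Γ → x * η / α ≤ D := fun x hx => by
    rw [hD]; gcongr
  have hret : m - 2 * D ≤ Q.H α S τ := by
    obtain ⟨j, hj, hjτ⟩ := hcand.exists_index
    have h1 := hdev S j
    -- The last search value may exceed `Γ`, but by less than `γ`, so the error there is at most
    -- twice `D`.
    have h2 : (j : ℝ) * γ ≤ 2 * Γ := by
      have h3 : (j : ℝ) ≤ ⌈Γ / γ⌉₊ := by exact_mod_cast hj
      have h4 := (Nat.ceil_lt_add_one (by positivity : 0 ≤ Γ / γ)).le
      calc (j : ℝ) * γ ≤ (Γ / γ + 1) * γ := mul_le_mul_of_nonneg_right (h3.trans h4) hγ.le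
        _ = Γ + γ := by field_simp
        _ ≤ 2 * Γ := by linarith
    have h5 : (j : ℝ) * γ * η / α ≤ 2 * D := by
      calc (j : ℝ) * γ * η / α ≤ 2 * Γ * η / α := by gcongr
        _ = 2 * D := by rw [hD]; ring
    have hval : Q.sampledH α ys S τ = m := hcand.value
    simp only at hjτ
    rw [← hjτ, hval] at h1
    rw [← hjτ] at h5
    linarith [(abs_le.1 h1).2]
  have hm := hcand.nonneg
  set i := ⌊τO / γ⌋₊ with hi
  set t := (i : ℝ) * γ with ht
  have ht0 : 0 ≤ t := by positivity
  have htO : t ≤ τO := by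
    have := Nat.floor_le (by positivity : 0 ≤ τO / γ)
    rwa [le_div_iff₀ hγ] at this
  have htO' : τO - t ≤ γ := by
    have := (Nat.lt_floor_add_one (τO / γ)).le
    rw [div_le_iff₀ hγ, add_mul] at this
    linarith
  have hround : Q.H α O τO - γ ≤ Q.H α O t := by linarith [Q.H_le_add hα O ht0 htO]
  have hiN : i ≤ ⌈Γ / γ⌉₊ := by
    refine (Nat.floor_le_floor (div_le_div_of_nonneg_right hτOΓ hγ.le)).trans (Nat.floor_le_ceil _)
  have hkey : Q.H α O t + (1 + k) * (Γ * (1 - 1 / α)) ≤ (2 + k) * m + (4 * nV + 1) * D := by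
    have hΓα : (1 + k) * (Γ * (1 - 1 / α)) ≤ 0 :=
      mul_nonpos_of_nonneg_of_nonpos (by linarith) (mul_nonpos_of_nonneg_of_nonpos hΓ.le hα1)
    rcases Nat.eq_zero_or_pos i with hi0 | hi0
    · have : t = 0 := by rw [ht, hi0]; simp
      rw [this, Q.H_zero]
      have : 0 ≤ (2 + k) * m := by positivity
      have : 0 ≤ (4 * nV + 1) * D := by positivity
      linarith
    · have hmono : ∀ x, 0 ≤ x → x ≤ Γ → Γ * (1 - 1 / α) ≤ x * (1 - 1 / α) := fun x _ hx =>
        mul_le_mul_of_nonpos_right hx hα1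
      rcases hsearch i (Nat.zero_le _) hiN with ⟨S', c, hrun', hc⟩ | ⟨j, hj, S', c, hrun', hc⟩
      · have h1 := Q.greedy_guarantee hn hα hγ hγΓ hns hi0 (htO.trans hτOΓ) (fun S => hdev S i) hOf hrun'
        have h2 := mul_le_mul_of_nonneg_left (hmono t ht0 (htO.trans hτOΓ)) (by linarith : 0 ≤ 1 + k)
        have h3 := mul_le_mul_of_nonneg_left (hscale t (htO.trans hτOΓ)) (by linarith : 0 ≤ 4 * nV + 1)
        have h4 := mul_le_mul_of_nonneg_left hc (by linarith : 0 ≤ 2 + k)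
        linarith
      -- Early exit at `t' ≤ t`: the negative greedy value bounds `H(O, t')` by a multiple of `t'`.
      -- The ratio `H(O, ·) / ·` being nonincreasing, the same multiple of `t` bounds `H(O, t)`; the
      -- factor is nonnegative, so `t` may be enlarged to `Γ`.
      · have hj0 : 0 < j := by
          rcases Nat.eq_zero_or_pos j with rfl | h
          · have h1 := (hrun'.isTour_and_value hn).2
            simp only [Nat.cast_zero, zero_mul, Q.sampledH_zero] at h1
            linarith
          · exact h
        set t' := (j : ℝ) * γ with ht'
        have ht'0 : 0 < t' := by positivity
        have ht't : t' ≤ t := mul_le_mul_of_nonneg_right (by exact_mod_cast hj) hγ.le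
        have h1 := Q.greedy_guarantee hn hα hγ hγΓ hns hj0 (ht't.trans (htO.trans hτOΓ)) (fun S => hdev S j) hOf hrun'
        have h2 : (2 + k) * c ≤ 0 := mul_nonpos_of_nonneg_of_nonpos (by linarith) hc.le
        have h3 := Q.mul_H_le_mul_H hα O ht'0.le ht't
        have h4 : Q.H α O t' ≤ t' * ((4 * nV + 1) * (η / α) - (1 + k) * (1 - 1 / α)) := by
          have : t' * ((4 * nV + 1) * (η / α) - (1 + k) * (1 - 1 / α)) =
            (4 * nV + 1) * (t' * η / α) - (1 + k) * (t' * (1 - 1 / α)) := by ring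
          linarith
        have h5 : Q.H α O t ≤ t * ((4 * nV + 1) * (η / α) - (1 + k) * (1 - 1 / α)) := by
          have h6 := mul_le_mul_of_nonneg_left h4 ht0
          refine le_of_mul_le_mul_left ?_ ht'0
          linarith
        have h6 : 0 ≤ (4 * nV + 1) * (η / α) - (1 + k) * (1 - 1 / α) := by
          have a1 : 0 ≤ (4 * nV + 1) * (η / α) := by positivity
          have a2 : (1 + k) * (1 - 1 / α) ≤ 0 := mul_nonpos_of_nonneg_of_nonpos (by linarith) hα1
          linarith
        have h7 := mul_le_mul_of_nonneg_right (htO.trans hτOΓ) h6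
        have h8 : Γ * ((4 * nV + 1) * (η / α) - (1 + k) * (1 - 1 / α)) =
          (4 * nV + 1) * D - (1 + k) * (Γ * (1 - 1 / α)) := by rw [hD]; ring
        have h9 : 0 ≤ (2 + k) * m := by positivity
        linarith
  refine le_trans ?_ hret
  have hk2 : 0 < 2 + k := by linarith
  have h1 : 1 / (2 + k) * (Q.H α O τO - γ) + (1 + k) / (2 + k) * (Γ * (1 - 1 / α)) =
      ((Q.H α O τO - γ) + (1 + k) * (Γ * (1 - 1 / α))) / (2 + k) := by ring
  have h2 : ((Q.H α O τO - γ) + (1 + k) * (Γ * (1 - 1 / α))) / (2 + k) ≤ m + (4 * nV + 1) / 2 * D := by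
    rw [div_le_iff₀ hk2]
    have h3 : 0 ≤ k * ((4 * nV + 1) / 2 * D) := by positivity
    linarith
  rw [h1]
  have h4 : 3 * D ≤ nV * D := mul_le_mul_of_nonneg_right hnV3 hD0
  linarith

/-- The samples whose empirical law is uniformly close to the law, over all edge sets and all search values. -/
def Problem.goodSamples (γ η : ℝ) (ns : ℕ) : Set (Fin ns → Yr × Yc) :=
  {ys | ∀ S, ∀ i : ℕ, |∑ j, truncRatio (i * γ) (Q.utility S (ys j)) -
    ns * ∫ y, truncRatio (i * γ) (Q.utility S y) ∂Q.law| ≤ ns * η}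

omit [DecidableEq V] in
lemma Problem.measurableSet_goodSamples (hγ : 0 < γ) : MeasurableSet (Q.goodSamples γ η ns) := by
  simp only [Problem.goodSamples, Set.ofPred_forall]
  refine MeasurableSet.iInter fun S => MeasurableSet.iInter fun i => ?_
  have h1 : Measurable fun y => truncRatio (i * γ) (Q.utility S y) :=
    (truncRatio_monotone (by positivity)).measurable.comp (Q.measurable_utility S)
  have h2 : Measurable fun ys : Fin ns → Yr × Yc => ∑ j, truncRatio (i * γ) (Q.utility S (ys j)) :=
    Finset.measurable_sum _ fun j _ => h1.comp (measurable_pi_apply j)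
  exact measurableSet_le (continuous_abs.measurable.comp (h2.sub measurable_const)) measurable_const

omit [DecidableEq V] in
lemma Problem.measure_goodSamples_compl_le (hγ : 0 < γ) (hη : 0 ≤ η) :
    (Measure.pi fun _ : Fin ns => Q.law) (Q.goodSamples γ η ns)ᶜ ≤
      ENNReal.ofReal (2 ^ Fintype.card (Sym2 V) * (4 * Real.exp (-(ns * η ^ 2 / 8)))) := by
  have := Q.isProbabilityMeasure_law
  have hsub : (Q.goodSamples γ η ns)ᶜ ⊆ ⋃ S, {ys | ∃ i : ℕ, ns * η < |∑ j, truncRatio (i * γ) (Q.utility S (ys j)) -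
      ns * ∫ y, truncRatio (i * γ) (Q.utility S y) ∂Q.law|} := by
    intro ys hys
    simp only [Problem.goodSamples, Set.mem_compl_iff, Set.mem_ofPred_eq] at hys
    push Not at hys
    simpa using hys
  refine (measure_mono hsub).trans ((measure_iUnion_fintype_le _ _).trans ?_)
  refine (Finset.sum_le_sum fun S _ => measure_monotone_deviation_le Q.law (Q.measurable_utility S)
    (u := fun i : ℕ => truncRatio (i * γ)) (fun i => truncRatio_monotone (by positivity))
    (fun i => truncRatio_nonneg (by positivity)) (fun i => truncRatio_le_one (by positivity)) ns hη).trans ?_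
  rw [Finset.sum_const, Finset.card_univ, Fintype.card_finset, nsmul_eq_mul,
    ENNReal.ofReal_mul (p := 2 ^ Fintype.card (Sym2 V)) (by positivity), ENNReal.ofReal_pow (by norm_num)]
  simp

end Guarantee

/-- Of the `c + 3` factors `δ / 2`, all but one are at most `1 / 2` and absorb `2 ^ c * 4`. -/
lemma two_pow_mul_exp_le {c : ℕ} {δ x : ℝ} (hδ₀ : 0 < δ) (hδ₁ : δ < 1) (hx : (c + 3) * Real.log (2 / δ) ≤ x) :
    2 ^ c * (4 * Real.exp (-x)) ≤ δ := by
  have h1 : Real.exp (-x) ≤ (δ / 2) ^ (c + 3) := by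
    calc Real.exp (-x) ≤ Real.exp (((c + 3 : ℕ) : ℝ) * -Real.log (2 / δ)) := by
          rw [Real.exp_le_exp]; push_cast; linarith
      _ = (δ / 2) ^ (c + 3) := by
          rw [Real.exp_nat_mul, Real.exp_neg, Real.exp_log (by positivity), inv_div]
  have h2 : (δ / 2) ^ (c + 3) ≤ (1 / 2) ^ (c + 2) * (δ / 2) := by
    rw [pow_succ]
    exact mul_le_mul_of_nonneg_right (pow_le_pow_left₀ (by positivity) (by linarith) _) (by positivity)
  calc 2 ^ c * (4 * Real.exp (-x)) ≤ 2 ^ c * (4 * ((1 / 2) ^ (c + 2) * (δ / 2))) := by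
        gcongr; exact h1.trans h2
    _ = δ / 2 := by
        rw [pow_add, one_div, inv_pow]
        field_simp
        norm_num
    _ ≤ δ := by linarith

end RiskTSP

theorem theorem1 (n : ℕ) (hn : 3 ≤ n) (α : ℝ) (hα₀ : 0 < α) (hα₁ : α ≤ 1) :
    ∃ K : ℝ, 0 < K ∧
      ∀ (V P Yr Yc : Type*) [Fintype V] [DecidableEq V] [DecidableEq P]
        [MeasurableSpace Yr] [MeasurableSpace Yc]
        (Q : RiskTSP.Problem V P Yr Yc) (Γ γ ε δ : ℝ) (ns : ℕ),
        Fintype.card V = n → 0 < Γ → 0 < γ → γ ≤ Γ →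
        0 < ε → ε < 1 → 0 < δ → δ < 1 →
        K * (Γ ^ 2 / ε ^ 2) * Real.log (2 / δ) ≤ (ns : ℝ) →
        (∀ ys : Fin ns → Yr × Yc,
          (∃ SG τG, RiskTSP.RAGAReturns (Q.sampledH α ys) Γ γ SG τG) ∧
          (∀ SG τG, RiskTSP.RAGAReturns (Q.sampledH α ys) Γ γ SG τG → RiskTSP.IsTour SG)) ∧
        ∃ good : Set (Fin ns → Yr × Yc), MeasurableSet good ∧
          ENNReal.ofReal (1 - δ) ≤ MeasureTheory.Measure.pi (fun _ : Fin ns => Q.law) good ∧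
          ∀ ys ∈ good, ∀ SG τG, RiskTSP.RAGAReturns (Q.sampledH α ys) Γ γ SG τG →
            ∀ Sstar τstar, Q.IsOptimal α Γ Sstar τstar →
              1 / (2 + Q.curvatureH α Γ γ) * (Q.H α Sstar τstar - γ)
                + (1 + Q.curvatureH α Γ γ) / (2 + Q.curvatureH α Γ γ) * (Γ * (1 - 1 / α)) - ε
              ≤ Q.H α SG τG := by
  have hn0 : (0 : ℝ) < n := by exact_mod_cast (by omega : 0 < n)
  -- Here `288 = 8 * 6 ^ 2` combines the deviation exponent `η ^ 2 / 8` with the 6 in the choice of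
  -- `η`, and `(n + 1).choose 2` is the size of `Sym2 V`, loops included, whose subsets enter the
  -- union bound.
  refine ⟨288 * n ^ 2 / α ^ 2 * ((n + 1).choose 2 + 3), by positivity, ?_⟩
  intro V P Yr Yc _ _ _ _ _ Q Γ γ ε δ ns hV hΓ hγ hγΓ hε₀ _ hδ₀ hδ₁ hns
  have hlog : 0 < Real.log (2 / δ) := Real.log_pos (by rw [lt_div_iff₀ hδ₀]; linarith)
  have hns0 : 0 < ns := by
    have : (0 : ℝ) < ns := lt_of_lt_of_le (by positivity) hns
    exact_mod_cast this
  have hV3 : 3 ≤ Fintype.card V := by omega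
  have := Q.isProbabilityMeasure_law
  refine ⟨fun ys => ⟨?_, fun SG τG h => h.isTour hV3 (Q.sampledH_zero α ys)⟩, ?_⟩
  · obtain ⟨b, hb⟩ := RiskTSP.exists_searchRun (Q.sampledH α ys) γ ⌈Γ / γ⌉₊ 0 0 (∅, 0)
    exact ⟨b.1, b.2, hb⟩
  -- Makes the total error `6 n Γ η / α` equal to `ε`.
  set η := α * ε / (6 * n * Γ) with hη
  have hη0 : 0 ≤ η := by positivity
  have hgood := Q.measurableSet_goodSamples (ns := ns) (η := η) hγ
  refine ⟨Q.goodSamples γ η ns, hgood, ?_, fun ys hys SG τG hrun Sstar τstar hopt => ?_⟩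
  · have h1 := Q.measure_goodSamples_compl_le (ns := ns) hγ hη0
    have h2 : 2 ^ Fintype.card (Sym2 V) * (4 * Real.exp (-(ns * η ^ 2 / 8))) ≤ δ := by
      refine RiskTSP.two_pow_mul_exp_le hδ₀ hδ₁ ?_
      rw [Sym2.card, hV]
      have h3 := mul_le_mul_of_nonneg_right hns (by positivity : 0 ≤ η ^ 2 / 8)
      refine le_trans (le_of_eq ?_) (h3.trans (le_of_eq (by ring)))
      rw [hη]
      field_simp
      norm_num
    have h3 := h1.trans (ENNReal.ofReal_le_ofReal h2)
    rw [prob_compl_eq_one_sub hgood] at h3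
    rw [ENNReal.ofReal_sub _ hδ₀.le, ENNReal.ofReal_one]
    exact tsub_le_iff_tsub_le.1 h3
  · have h1 := Q.raga_guarantee hV3 hα₀ hα₁ hγ hγΓ hη0 hns0
      (fun S i => Q.abs_sampledH_sub_le hα₀ hns0 (by positivity) ys S (hys S i)) hrun hopt
    have h2 : 6 * (Fintype.card V : ℝ) * (Γ * η / α) = ε := by
      rw [hV, hη]; field_simp
    rwa [h2] at h1
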